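/- Let $n\ge 2$, and write $\mathcal S^{n+1}\setminus\{\mathrm{NP},\mathrm{SP}\}=(-1,1)\times\mathcal S^n$ (the north pole $\mathrm{NP}$ being at $x=1$), so that an $\mathrm{SO}(n+1)$-invariant metric has the form $g=\varphi(x)^2dx^2+\psi(x)^2g_{\mathrm{can}}$ with $\varphi,\psi>0$. A \emph{neckpinch metric} is an $\mathrm{SO}(n+1)$-invariant smooth Riemannian metric $g_0$ on $\mathcal S^{n+1}\setminus\{\mathrm{NP}\}$ which, in terms of the $g_0$-distance $s\in(0,\ell)$ to $\mathrm{NP}$, is $g_0=ds^2+\psi_0(s)^2g_{\mathrm{can}}$, where $0<\ell<\infty$, $\psi_0\in C^\infty((0,\ell))\cap C^1([0,\ell])$ and: $\psi_0>0$ on $(0,\ell)$; $\psi_0(0)=\psi_0(\ell)=0$; $\psi_0'(\ell)=-1$; $\psi_0(s)^2=\bigl(\tfrac{n-1}4+o(1)\bigr)\frac{s^2}{-\log s}$ and $\psi_0(s)\psi_0'(s)=\bigl(\tfrac{n-1}4+o(1)\bigr)\frac{s}{-\log s}$ as $s\searrow0$; $|\psi_0'|\le1$ on $(0,\ell)$;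 there is $r_\#>0$ such that $\psi_0'(s)\ne0$ whenever $\psi_0(s)<2r_\#$; and $\psi_0\psi_0''-(\psi_0')^2+1$ is bounded on $(0,\ell)$. A \emph{smooth complete rotationally symmetric forward evolution} of $g_0$ is a smooth solution $(\mathcal M,g(t))$, $0<t<T$, of Ricci flow $\partial_t g=-2\,\mathrm{Rc}$ by complete $\mathrm{SO}(n+1)$-invariant metrics, where $\mathcal M$ is either $\mathcal S^{n+1}$ or $\mathcal S^{n+1}\setminus\{\mathrm{NP}\}$, such that $g(t)\to g_0$ smoothly on compact subsets of $\mathcal S^{n+1}\setminus\{\mathrm{NP}\}$ as $t\searrow0$; in the case $\mathcal M=\mathcal S^{n+1}\setminus\{\mathrm{NP}\}$ it is understood that the singular point stays at $r=0$, that is, for some $t_1\in(0,T)$ the radii satisfy $\psi(x,t)\to0$ as $x\nearrow1$, uniformly for $0<t<t_1$. \textbf{Theorem.} Let $(\mathcal M,g(t))$, $0<t<T$, be a smooth complete rotationally symmetric forward evolution of a neckpinch metric $g_0$. Then $\mathcal M$ is compact (so $\mathcal M=\mathcal S^{n+1}$). Moreover, for every $t\in(0,T)$, $r=\psi(\cdot,t)$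 is a coordinate on a punctured neighbourhood of $\mathrm{NP}$, with range $0<r<r_1(t)$ and $\mathrm{NP}$ at $r=0$, in which \[ g(t)=\frac{(dr)^2}{v(r,t)}+r^2g_{\mathrm{can}}, \] and $v(\cdot,t)$ extends continuously to $r=0$ with $v(0,t)=1$. -/

import Mathlib

open Set Filter Topology
open scoped ContDiff ENNReal

namespace Neckpinch

noncomputable section

/-! ### The sphere `S^{n+1}` -/

/-- The space `ℝ^{n+1}`: model space of the charts; `SO(n+1)` acts on it. -/
abbrev Model (n : ℕ) : Type := EuclideanSpace ℝ (Fin (n + 1))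

/-- The space `ℝ^{n+1} × ℝ = ℝ^{n+2}` with its Euclidean norm, in which `S^{n+1}` sits. -/
abbrev Ambient (n : ℕ) : Type := WithLp 2 (Model n × ℝ)

/-- The unit sphere `S^{n+1}`. -/
def unitSphere (n : ℕ) : Set (Ambient n) := Metric.sphere 0 1

/-- The north pole `NP = (0, 1)`. -/
def northPole (n : ℕ) : Ambient n := WithLp.toLp 2 (0, 1)

/-- Inverse stereographic projection from the north pole: it maps `ℝ^{n+1}` onto
`S^{n+1} ∖ {NP}`. -/
def stereoN (n : ℕ) (y : Model n) : Ambient n :=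
  WithLp.toLp 2 ((2 / (‖y‖ ^ 2 + 1)) • y, (‖y‖ ^ 2 - 1) / (‖y‖ ^ 2 + 1))

/-- Inverse stereographic projection from the south pole: it maps `ℝ^{n+1}` onto
`S^{n+1} ∖ {SP}`, and `0` to `NP`. -/
def stereoS (n : ℕ) (y : Model n) : Ambient n :=
  WithLp.toLp 2 ((2 / (‖y‖ ^ 2 + 1)) • y, (1 - ‖y‖ ^ 2) / (‖y‖ ^ 2 + 1))

/-- The two stereographic parametrizations, which form an atlas of `S^{n+1}`. -/
def atlas (n : ℕ) : Set (Model n → Ambient n) := {stereoN n, stereoS n}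

/-! ### Fields of bilinear forms and Riemannian metrics on open subsets of the sphere -/

/-- A field of bilinear forms. At a point `p` of the sphere only the values on tangent vectors
(the vectors orthogonal to `p`) are ever used. -/
abbrev FormField (n : ℕ) : Type := Ambient n → Ambient n →L[ℝ] Ambient n →L[ℝ] ℝ

/-- The `i`-th coordinate vector of `ℝ^{n+1}`. -/
def coordVec (n : ℕ) (i : Fin (n + 1)) : Model n := EuclideanSpace.single i 1

/-- The coefficients `g_{ij}` of `g` in the coordinates given by the parametrization `σ`. -/
def coeff {n : ℕ} (g : FormField n) (σ : Model n → Ambient n) (y : Model n) :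
    Matrix (Fin (n + 1)) (Fin (n + 1)) ℝ :=
  Matrix.of fun i j =>
    g (σ y) (fderiv ℝ σ y (coordVec n i)) (fderiv ℝ σ y (coordVec n j))

/-- `g` is a smooth Riemannian metric on the open subset `M` of the sphere. -/
def IsRiemannianMetric {n : ℕ} (M : Set (Ambient n)) (g : FormField n) : Prop :=
  ∀ σ ∈ atlas n,
    (∀ y ∈ σ ⁻¹' M, (coeff g σ y).PosDef) ∧
    ∀ i j, ContDiffOn ℝ ∞ (fun y => coeff g σ y i j) (σ ⁻¹' M)

/-! ### Ricci curvature in coordinates -/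

/-- The partial derivative `∂_i f`. -/
def partialD {n : ℕ} (i : Fin (n + 1)) (f : Model n → ℝ) (y : Model n) : ℝ :=
  fderiv ℝ f y (coordVec n i)

/-- The Christoffel symbol `Γ^k_{ij}` of the coefficients `G`. -/
def christoffel {n : ℕ} (G : Model n → Matrix (Fin (n + 1)) (Fin (n + 1)) ℝ)
    (k i j : Fin (n + 1)) (y : Model n) : ℝ :=
  (1 / 2) * ∑ l, (G y)⁻¹ k l *
    (partialD i (fun z => G z j l) y + partialD j (fun z => G z i l) y
      - partialD l (fun z => G z i j) y)

/-- The component `R_{ij}` of the Ricci tensor of the coefficients `G`. -/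
def ricci {n : ℕ} (G : Model n → Matrix (Fin (n + 1)) (Fin (n + 1)) ℝ)
    (i j : Fin (n + 1)) (y : Model n) : ℝ :=
  ∑ k, (partialD k (christoffel G k i j) y - partialD j (christoffel G k i k) y)
    + ∑ k, ∑ l, (christoffel G k k l y * christoffel G l i j y
        - christoffel G k j l y * christoffel G l i k y)

/-- `(M, g(t) : 0 < t < T)` is a smooth solution of Ricci flow `∂g/∂t = -2 Rc`. -/
def IsRicciFlow {n : ℕ} (M : Set (Ambient n)) (T : ℝ) (g : ℝ → FormField n) : Prop :=
  (∀ t ∈ Ioo 0 T, IsRiemannianMetric M (g t)) ∧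
  ∀ σ ∈ atlas n, ∀ i j,
    ContDiffOn ℝ ∞ (fun z : ℝ × Model n => coeff (g z.1) σ z.2 i j) (Ioo 0 T ×ˢ (σ ⁻¹' M)) ∧
    ∀ t ∈ Ioo 0 T, ∀ y ∈ σ ⁻¹' M,
      HasDerivAt (fun s => coeff (g s) σ y i j) (-2 * ricci (coeff (g t) σ) i j y) t

/-! ### Completeness -/

/-- The `g`-length of a curve `γ : [0,1] → S^{n+1}`. -/
def curveLength {n : ℕ} (g : FormField n) (γ : ℝ → Ambient n) : ℝ≥0∞ :=
  ∫⁻ τ in Icc (0 : ℝ) 1, ENNReal.ofReal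
    (Real.sqrt (g (γ τ) (derivWithin γ (Icc 0 1) τ) (derivWithin γ (Icc 0 1) τ)))

/-- The `C¹` curves in `M` from `p` to `q`. -/
def curvesIn {n : ℕ} (M : Set (Ambient n)) (p q : Ambient n) : Set (ℝ → Ambient n) :=
  {γ | ContDiffOn ℝ 1 γ (Icc 0 1) ∧ MapsTo γ (Icc 0 1) M ∧ γ 0 = p ∧ γ 1 = q}

/-- The Riemannian distance of `(M, g)`. -/
def riemDist {n : ℕ} (M : Set (Ambient n)) (g : FormField n) (p q : Ambient n) : ℝ≥0∞ :=
  ⨅ γ ∈ curvesIn M p q, curveLength g γ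

/-- `(M, g)` is complete: every sequence that is Cauchy for the Riemannian distance converges
in `M` (for the topology of `M`, which is the one that the Riemannian distance induces). -/
def IsCompleteMetric {n : ℕ} (M : Set (Ambient n)) (g : FormField n) : Prop :=
  ∀ u : ℕ → Ambient n, (∀ k, u k ∈ M) →
    (∀ ε : ℝ≥0∞, 0 < ε → ∃ N, ∀ k ≥ N, ∀ l ≥ N, riemDist M g (u k) (u l) < ε) →
    ∃ p ∈ M, Tendsto u atTop (𝓝 p)

/-! ### Rotational symmetry -/

/-- The action of a linear isometry of `ℝ^{n+1}` on `ℝ^{n+2}`, fixing the axis through the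
poles. -/
def rotate {n : ℕ} (R : Model n ≃ₗᵢ[ℝ] Model n) (p : Ambient n) : Ambient n :=
  WithLp.toLp 2 (R p.fst, p.snd)

/-- `g` is an `SO(n+1)`-invariant metric on `M`. -/
def IsRotationallySymmetric {n : ℕ} (M : Set (Ambient n)) (g : FormField n) : Prop :=
  ∀ R : Model n ≃ₗᵢ[ℝ] Model n, LinearMap.det (R.toLinearEquiv : Model n →ₗ[ℝ] Model n) = 1 →
    ∀ p ∈ M, ∀ u w : Ambient n, inner ℝ p u = 0 → inner ℝ p w = 0 →
      g (rotate R p) (rotate R u) (rotate R w) = g p u w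

/-- A meridian from the south pole (`x = -1`) to the north pole (`x = 1`); the orbits of
`SO(n+1)` other than the poles are the spheres through `meridian n x`, `-1 < x < 1`, so that
`S^{n+1} ∖ {NP, SP} = (-1,1) × S^n`. -/
def meridian (n : ℕ) (x : ℝ) : Ambient n :=
  WithLp.toLp 2 (Real.sqrt (1 - x ^ 2) • coordVec n 0, x)

/-- The function `φ` of a rotationally symmetric metric `g = φ(x)² dx² + ψ(x)² g_can`. -/
def meridianSpeed {n : ℕ} (g : FormField n) (x : ℝ) : ℝ :=
  Real.sqrt (g (meridian n x) (deriv (meridian n) x) (deriv (meridian n) x))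

/-- The function `ψ` of a rotationally symmetric metric `g = φ(x)² dx² + ψ(x)² g_can`:
the `g`-length of a tangent vector of `{x} × S^n` that is a unit vector for `g_can`. -/
def orbitRadius {n : ℕ} (g : FormField n) (x : ℝ) : ℝ :=
  let w : Ambient n := WithLp.toLp 2 (Real.sqrt (1 - x ^ 2) • coordVec n (Fin.last n), 0)
  Real.sqrt (g (meridian n x) w w)

/-- On the punctured neighbourhood `x₁ < x < 1` of the north pole, `r = ψ(x)` is a coordinate
with range `0 < r < r₁` (the pole being at `r = 0`), in which `g = dr² / v(r) + r² g_can`. -/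
structure IsRadialProfile {n : ℕ} (g : FormField n) (x₁ r₁ : ℝ) (v : ℝ → ℝ) : Prop where
  mem : x₁ ∈ Ioo (-1 : ℝ) 1
  pos : 0 < r₁
  bijOn : BijOn (orbitRadius g) (Ioo x₁ 1) (Ioo 0 r₁)
  differentiable : ∀ x ∈ Ioo x₁ 1, DifferentiableAt ℝ (orbitRadius g) x
  deriv_neg : ∀ x ∈ Ioo x₁ 1, deriv (orbitRadius g) x < 0
  profile_pos : ∀ r ∈ Ioo 0 r₁, 0 < v r
  metric_eq : ∀ x ∈ Ioo x₁ 1,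
    meridianSpeed g x ^ 2 = deriv (orbitRadius g) x ^ 2 / v (orbitRadius g x)

/-! ### Neckpinch metrics and their forward evolutions -/

/-- The conditions on the warping function of a singular metric `ds² + ψ₀(s)² g_can`
(`0 < s < ℓ`, the distance to the singular point) produced by a neckpinch. -/
structure IsNeckpinchWarping (n : ℕ) (ℓ : ℝ) (ψ₀ : ℝ → ℝ) : Prop where
  length_pos : 0 < ℓ
  smooth : ContDiffOn ℝ ∞ ψ₀ (Ioo 0 ℓ)
  c1 : ContDiffOn ℝ 1 ψ₀ (Icc 0 ℓ)
  pos : ∀ s ∈ Ioo 0 ℓ, 0 < ψ₀ s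
  zero_left : ψ₀ 0 = 0
  zero_right : ψ₀ ℓ = 0
  deriv_right : HasDerivWithinAt ψ₀ (-1) (Icc 0 ℓ) ℓ
  asymp : Tendsto (fun s => ψ₀ s ^ 2 / (s ^ 2 / (-Real.log s))) (𝓝[>] 0)
    (𝓝 (((n : ℝ) - 1) / 4))
  asymp_deriv : Tendsto (fun s => ψ₀ s * deriv ψ₀ s / (s / (-Real.log s))) (𝓝[>] 0)
    (𝓝 (((n : ℝ) - 1) / 4))
  deriv_le : ∀ s ∈ Ioo 0 ℓ, |deriv ψ₀ s| ≤ 1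
  no_small_neck : ∃ r > 0, ∀ s ∈ Ioo 0 ℓ, ψ₀ s < 2 * r → deriv ψ₀ s ≠ 0
  curvature_bound : ∃ A : ℝ, ∀ s ∈ Ioo 0 ℓ,
    |ψ₀ s * deriv (deriv ψ₀) s - deriv ψ₀ s ^ 2 + 1| ≤ A

/-- `g₀` is a singular metric on `S^{n+1}` resulting from a rotationally symmetric neckpinch,
with its singularity at the north pole. -/
structure IsNeckpinchMetric {n : ℕ} (g₀ : FormField n) : Prop where
  metric : IsRiemannianMetric (unitSphere n \ {northPole n}) g₀
  symmetric : IsRotationallySymmetric (unitSphere n \ {northPole n}) g₀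
  /-- `s x` is the distance from the north pole to the orbit with parameter `x`. -/
  warping : ∃ (ℓ : ℝ) (ψ₀ s : ℝ → ℝ), IsNeckpinchWarping n ℓ ψ₀ ∧
    (∀ x ∈ Ioo (-1 : ℝ) 1, HasDerivAt s (-meridianSpeed g₀ x) x) ∧
    Tendsto s (𝓝[<] 1) (𝓝 0) ∧ Tendsto s (𝓝[>] (-1)) (𝓝 ℓ) ∧
    ∀ x ∈ Ioo (-1 : ℝ) 1, orbitRadius g₀ x = ψ₀ (s x)

/-- `g(t)` converges to `g₀` as `t ↘ 0`, smoothly (with all derivatives, uniformly) on compact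
subsets of `S^{n+1} ∖ {NP}`. -/
def ConvergesSmoothly {n : ℕ} (g : ℝ → FormField n) (g₀ : FormField n) : Prop :=
  ∀ (i j : Fin (n + 1)) (k : ℕ) (K : Set (Model n)), IsCompact K →
    TendstoUniformlyOn
      (fun t y => iteratedFDeriv ℝ k (fun z => coeff (g t) (stereoN n) z i j) y)
      (fun y => iteratedFDeriv ℝ k (fun z => coeff g₀ (stereoN n) z i j) y)
      (𝓝[>] (0 : ℝ)) K

/-- `(M, g(t) : 0 < t < T)` is a smooth complete rotationally symmetric forward evolution, by
Ricci flow, of the singular metric `g₀`. It lives on the sphere or on the sphere without the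
singular point. In the second case the singular point (or the end that replaces it) stays at
`r = 0` for a short time: `ψ(x,t) → 0` as `x` tends to the pole, uniformly for small `t`; in the
first case this is automatic at each time. -/
structure IsForwardEvolution {n : ℕ} (g₀ : FormField n) (M : Set (Ambient n)) (T : ℝ)
    (g : ℝ → FormField n) : Prop where
  time_pos : 0 < T
  manifold : M = unitSphere n ∨ M = unitSphere n \ {northPole n}
  flow : IsRicciFlow M T g
  complete : ∀ t ∈ Ioo 0 T, IsCompleteMetric M (g t)
  symmetric : ∀ t ∈ Ioo 0 T, IsRotationallySymmetric M (g t)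
  initial : ConvergesSmoothly g g₀
  radius_tendsto : M = unitSphere n \ {northPole n} →
    ∃ t₁ ∈ Ioo 0 T, TendstoUniformlyOn (fun x t => orbitRadius (g t) x) (fun _ => 0)
      (𝓝[<] (1 : ℝ)) (Ioo 0 t₁)

end

end Neckpinch

namespace Neckpinch

noncomputable section

/-! ### Ricci curvature of rotationally symmetric coefficients -/

/-- The Kronecker symbol. -/
def kron {n : ℕ} (i j : Fin (n + 1)) : ℝ := if i = j then 1 else 0

lemma hasFDerivAt_radial {n : ℕ} {f : ℝ → ℝ} {f' : ℝ} {y : Model n}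
    (hf : HasDerivAt f f' (‖y‖ ^ 2)) :
    HasFDerivAt (fun z : Model n => f (‖z‖ ^ 2)) (f' • (2 • innerSL ℝ y)) y := by
  have h := hf.comp_hasFDerivAt y (hasStrictFDerivAt_norm_sq y).hasFDerivAt
  exact h

lemma hasFDerivAt_coord {n : ℕ} (i : Fin (n + 1)) (y : Model n) :
    HasFDerivAt (fun z : Model n => z i) (EuclideanSpace.proj i : Model n →L[ℝ] ℝ) y :=
  (EuclideanSpace.proj i : Model n →L[ℝ] ℝ).hasFDerivAt

lemma inner_coordVec {n : ℕ} (y : Model n) (i : Fin (n + 1)) :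
    inner ℝ y (coordVec n i) = y i := by
  simp [coordVec, EuclideanSpace.inner_single_right]

lemma coordVec_apply {n : ℕ} (i m : Fin (n + 1)) : coordVec n m i = kron i m := by
  simp [coordVec, kron]

lemma partialD_congr {n : ℕ} {f g : Model n → ℝ} {y : Model n} (h : f =ᶠ[𝓝 y] g)
    (i : Fin (n + 1)) : partialD i f y = partialD i g y := by
  rw [partialD, partialD, h.fderiv_eq]

lemma partialD_coeff_radial {n : ℕ} {a b : ℝ → ℝ} {a' b' : ℝ} {y : Model n}
    (ha : HasDerivAt a a' (‖y‖ ^ 2)) (hb : HasDerivAt b b' (‖y‖ ^ 2)) (m i j : Fin (n + 1)) :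
    partialD m (fun z : Model n => a (‖z‖ ^ 2) * kron i j + b (‖z‖ ^ 2) * z i * z j) y =
      2 * a' * y m * kron i j + 2 * b' * y m * y i * y j
        + b (‖y‖ ^ 2) * (kron i m * y j + y i * kron j m) := by
  have h := ((hasFDerivAt_radial ha).mul_const (kron i j)).add
    (((hasFDerivAt_radial hb).mul (hasFDerivAt_coord i y)).mul (hasFDerivAt_coord j y))
  rw [partialD]
  erw [h.fderiv]
  simp [inner_coordVec, coordVec_apply]
  ring

lemma partialD_christoffel_radial {n : ℕ} {A P Q : ℝ → ℝ} {A' P' Q' : ℝ} {y : Model n}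
    (hA : HasDerivAt A A' (‖y‖ ^ 2)) (hP : HasDerivAt P P' (‖y‖ ^ 2))
    (hQ : HasDerivAt Q Q' (‖y‖ ^ 2)) (m k i j : Fin (n + 1)) :
    partialD m (fun z : Model n => A (‖z‖ ^ 2) * (z i * kron j k + z j * kron i k)
        + P (‖z‖ ^ 2) * z k * kron i j + Q (‖z‖ ^ 2) * (z i * z j * z k)) y =
      2 * A' * y m * (y i * kron j k + y j * kron i k)
        + A (‖y‖ ^ 2) * (kron i m * kron j k + kron j m * kron i k)
        + 2 * P' * y m * y k * kron i j + P (‖y‖ ^ 2) * kron k m * kron i j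
        + 2 * Q' * y m * (y i * y j * y k)
        + Q (‖y‖ ^ 2) * (kron i m * y j * y k + y i * kron j m * y k + y i * y j * kron k m) := by
  have h := (((hasFDerivAt_radial hA).mul
    (((hasFDerivAt_coord i y).mul_const (kron j k)).add
      ((hasFDerivAt_coord j y).mul_const (kron i k)))).add
    (((hasFDerivAt_radial hP).mul (hasFDerivAt_coord k y)).mul_const (kron i j))).add
    ((hasFDerivAt_radial hQ).mul
      (((hasFDerivAt_coord i y).mul (hasFDerivAt_coord j y)).mul (hasFDerivAt_coord k y)))
  rw [partialD]
  erw [h.fderiv]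
  simp [inner_coordVec, coordVec_apply]
  ring

lemma sum_kron_mul {n : ℕ} (i : Fin (n + 1)) (f : Fin (n + 1) → ℝ) :
    ∑ l, kron i l * f l = f i := by
  simp [kron]

lemma kron_comm {n : ℕ} (i j : Fin (n + 1)) : kron i j = kron j i := by
  simp [kron, eq_comm]

lemma sum_sq_eq {n : ℕ} (y : Model n) : ∑ l, y l * y l = ‖y‖ ^ 2 := by
  rw [EuclideanSpace.real_norm_sq_eq]
  exact Finset.sum_congr rfl fun l _ => (sq _).symm

lemma inv_radial {n : ℕ} {a b : ℝ} {y : Model n} (ha : a ≠ 0) (hab : a + b * ‖y‖ ^ 2 ≠ 0) :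
    (Matrix.of fun i j => a * kron i j + b * y i * y j :
      Matrix (Fin (n + 1)) (Fin (n + 1)) ℝ)⁻¹ =
    Matrix.of fun i j => a⁻¹ * (kron i j - b / (a + b * ‖y‖ ^ 2) * y i * y j) := by
  apply Matrix.inv_eq_right_inv
  ext i j
  rw [Matrix.mul_apply, Matrix.one_apply]
  simp only [Matrix.of_apply]
  have h1 : ∀ l, (a * kron i l + b * y i * y l) *
      (a⁻¹ * (kron l j - b / (a + b * ‖y‖ ^ 2) * y l * y j)) =
      kron i l * (kron l j - b / (a + b * ‖y‖ ^ 2) * y l * y j)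
      + kron j l * (b * a⁻¹ * y i * y l)
      - (b * a⁻¹ * b / (a + b * ‖y‖ ^ 2) * y i * y j) * (y l * y l) := by
    intro l
    rw [kron_comm j l]
    field_simp
    ring
  simp only [h1, Finset.sum_add_distrib, Finset.sum_sub_distrib, sum_kron_mul,
    ← Finset.mul_sum, sum_sq_eq]
  change _ = kron i j
  field_simp
  ring

lemma christoffel_radial {n : ℕ} {a b : ℝ → ℝ} {a' b' : ℝ} {y : Model n}
    {G : Model n → Matrix (Fin (n + 1)) (Fin (n + 1)) ℝ}
    (hG : ∀ᶠ z in 𝓝 y, G z = Matrix.of fun i j => a (‖z‖ ^ 2) * kron i j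
      + b (‖z‖ ^ 2) * z i * z j)
    (ha : HasDerivAt a a' (‖y‖ ^ 2)) (hb : HasDerivAt b b' (‖y‖ ^ 2))
    (ha0 : a (‖y‖ ^ 2) ≠ 0) (hab : a (‖y‖ ^ 2) + b (‖y‖ ^ 2) * ‖y‖ ^ 2 ≠ 0)
    (k i j : Fin (n + 1)) :
    christoffel G k i j y = a' / a (‖y‖ ^ 2) * (y i * kron j k + y j * kron i k)
      + (b (‖y‖ ^ 2) - a') / (a (‖y‖ ^ 2) + b (‖y‖ ^ 2) * ‖y‖ ^ 2) * y k * kron i j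
      + (b' - 2 * a' * b (‖y‖ ^ 2) / a (‖y‖ ^ 2)) / (a (‖y‖ ^ 2) + b (‖y‖ ^ 2) * ‖y‖ ^ 2)
        * (y i * y j * y k) := by
  have hp : ∀ m p r, partialD m (fun z => G z p r) y =
      2 * a' * y m * kron p r + 2 * b' * y m * y p * y r
        + b (‖y‖ ^ 2) * (kron p m * y r + y p * kron r m) := by
    intro m p r
    rw [← partialD_coeff_radial ha hb]
    apply partialD_congr
    filter_upwards [hG] with z hz
    rw [hz]; rfl
  rw [christoffel]
  simp only [hp, hG.self_of_nhds, inv_radial ha0 hab, Matrix.of_apply]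
  set α := a (‖y‖ ^ 2)
  set β := b (‖y‖ ^ 2)
  have h1 : ∀ l, α⁻¹ * (kron k l - β / (α + β * ‖y‖ ^ 2) * y k * y l) *
      (2 * a' * y i * kron j l + 2 * b' * y i * y j * y l + β * (kron j i * y l + y j * kron l i)
        + (2 * a' * y j * kron i l + 2 * b' * y j * y i * y l
          + β * (kron i j * y l + y i * kron l j))
        - (2 * a' * y l * kron i j + 2 * b' * y l * y i * y j
          + β * (kron i l * y j + y i * kron j l))) =
      kron k l * (α⁻¹ * (2 * a' * (y i * kron j l + y j * kron i l - y l * kron i j)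
        + 2 * b' * y i * y j * y l + 2 * β * kron i j * y l))
      - kron j l * (α⁻¹ * (β / (α + β * ‖y‖ ^ 2)) * y k * y l * 2 * a' * y i)
      - kron i l * (α⁻¹ * (β / (α + β * ‖y‖ ^ 2)) * y k * y l * 2 * a' * y j)
      - (α⁻¹ * (β / (α + β * ‖y‖ ^ 2)) * y k) *
        (2 * b' * y i * y j + 2 * β * kron i j - 2 * a' * kron i j) * (y l * y l) := by
    intro l
    rw [kron_comm l i, kron_comm l j, kron_comm j i]
    ring
  simp only [h1, Finset.sum_sub_distrib, sum_kron_mul, ← Finset.mul_sum, sum_sq_eq]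
  field_simp
  ring

/-- The Ricci tensor of radial coefficients, in terms of the radial Christoffel symbols. -/
lemma ricci_radial {n : ℕ} {A P Q : ℝ → ℝ} {A' P' Q' : ℝ} {y : Model n}
    {G : Model n → Matrix (Fin (n + 1)) (Fin (n + 1)) ℝ}
    (hΓ : ∀ᶠ z in 𝓝 y, ∀ k i j, christoffel G k i j z =
      A (‖z‖ ^ 2) * (z i * kron j k + z j * kron i k)
        + P (‖z‖ ^ 2) * z k * kron i j + Q (‖z‖ ^ 2) * (z i * z j * z k))
    (hA : HasDerivAt A A' (‖y‖ ^ 2)) (hP : HasDerivAt P P' (‖y‖ ^ 2))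
    (hQ : HasDerivAt Q Q' (‖y‖ ^ 2)) (i j : Fin (n + 1)) (q α π κ H H' : ℝ)
    (hq : q = ‖y‖ ^ 2) (hα : α = A q) (hπ : π = P q) (hκ : κ = Q q)
    (hH : H = ((n : ℝ) + 2) * α + π + q * κ)
    (hH' : H' = ((n : ℝ) + 2) * A' + P' + κ + q * Q') :
    ricci G i j y =
      (2 * α + ((n : ℝ) + 1) * π + 2 * P' * q - H + H * π * q - 2 * α * π * q) * kron i j
      + (4 * A' + ((n : ℝ) + 3) * κ + 2 * Q' * q - 2 * H' + H * (2 * α + κ * q)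
        - (((n : ℝ) + 4) * α ^ 2 + 2 * α * π + 4 * α * κ * q + π ^ 2 + 2 * π * κ * q
          + κ ^ 2 * q ^ 2)) * (y i * y j) := by
  subst hα hπ hκ hH hH' hq
  have hp : ∀ m k i j, partialD m (christoffel G k i j) y =
      2 * A' * y m * (y i * kron j k + y j * kron i k)
        + A (‖y‖ ^ 2) * (kron i m * kron j k + kron j m * kron i k)
        + 2 * P' * y m * y k * kron i j + P (‖y‖ ^ 2) * kron k m * kron i j
        + 2 * Q' * y m * (y i * y j * y k)
        + Q (‖y‖ ^ 2) * (kron i m * y j * y k + y i * kron j m * y k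
          + y i * y j * kron k m) := by
    intro m k i j
    rw [← partialD_christoffel_radial hA hP hQ]
    apply partialD_congr
    filter_upwards [hΓ] with z hz
    exact hz k i j
  have hself : ∀ k : Fin (n + 1), kron k k = 1 := fun k => by simp [kron]
  rw [ricci]
  simp only [hp, hΓ.self_of_nhds, hself]
  set α := A (‖y‖ ^ 2)
  set π := P (‖y‖ ^ 2)
  set κ := Q (‖y‖ ^ 2)
  have h1 : ∀ k, 2 * A' * y k * (y i * kron j k + y j * kron i k)
        + α * (kron i k * kron j k + kron j k * kron i k)
        + 2 * P' * y k * y k * kron i j + π * 1 * kron i j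
        + 2 * Q' * y k * (y i * y j * y k)
        + κ * (kron i k * y j * y k + y i * kron j k * y k + y i * y j * 1)
      - (2 * A' * y j * (y i * 1 + y k * kron i k)
        + α * (kron i j * 1 + kron k j * kron i k)
        + 2 * P' * y j * y k * kron i k + π * kron k j * kron i k
        + 2 * Q' * y j * (y i * y k * y k)
        + κ * (kron i j * y k * y k + y i * kron k j * y k + y i * y k * kron k j)) =
      kron j k * (2 * A' * y k * y i - κ * (y i * y k))
      + kron i k * (2 * A' * y k * y j + α * kron j k
          + κ * (y j * y k) - 2 * A' * y j * y k - 2 * P' * y j * y k - π * kron j k)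
      + (π * kron i j + κ * (y i * y j) - 2 * A' * y j * y i - α * kron i j)
      + (2 * P' * kron i j - κ * kron i j) * (y k * y k) := by
    intro k
    rw [kron_comm k j]
    ring
  have h2 : ∀ k l, (α * (y k * kron l k + y l * 1) + π * y k * kron k l + κ * (y k * y l * y k))
        * (α * (y i * kron j l + y j * kron i l) + π * y l * kron i j + κ * (y i * y j * y l))
      - (α * (y j * kron l k + y l * kron j k) + π * y k * kron j l + κ * (y j * y l * y k))
        * (α * (y i * kron k l + y k * kron i l) + π * y l * kron i k + κ * (y i * y k * y l)) =
      kron k l * ((α + π) * y k * (α * (y i * kron j l + y j * kron i l) + π * y l * kron i j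
          + κ * (y i * y j * y l))
        - α * y j * (α * (y i * kron l l + y k * kron i l) + π * y l * kron i k
          + κ * (y i * y k * y l)) - α * y i * (y l * α * kron j k + π * y k * kron j l
          + κ * (y j * y l * y k)))
      + kron i l * (α * y j * (α * y l + κ * (y k * y l * y k))
        - α * y k * (α * y l * kron j k + π * y k * kron j l + κ * (y j * y l * y k)))
      + kron j l * (α * y i * (α * y l + κ * (y k * y l * y k))
        - π * y k * (π * y l * kron i k + κ * (y i * y k * y l)))
      + (π * kron i j + κ * (y i * y j)) * (α + κ * (y k * y k)) * (y l * y l)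
      - (kron j k * (α * (π * kron i k + κ * (y i * y k)))
        + kron i k * (κ * y j * y k * π) + κ * y j * κ * y i * (y k * y k)) * (y l * y l) := by
    intro k l
    rw [kron_comm l k]
    have e1 : kron k l * kron k l = kron k l := by simp [kron]
    have e2 : kron l l = 1 := hself l
    rw [e2]
    linear_combination (-(α * y j * α * y i)) * e1
  have h3 : ∀ k, ∑ l, ((α * (y k * kron l k + y l * 1) + π * y k * kron k l
          + κ * (y k * y l * y k))
        * (α * (y i * kron j l + y j * kron i l) + π * y l * kron i j + κ * (y i * y j * y l))
      - (α * (y j * kron l k + y l * kron j k) + π * y k * kron j l + κ * (y j * y l * y k))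
        * (α * (y i * kron k l + y k * kron i l) + π * y l * kron i k
          + κ * (y i * y k * y l))) =
      kron j k * (-(α ^ 2 * y k * y i) - α * ‖y‖ ^ 2 * (π * kron i k + κ * (y i * y k)))
      + kron i k * (-(π ^ 2 * y k * y j) - κ * y j * y k * π * ‖y‖ ^ 2)
      + (α ^ 2 * y i * y j + (π * kron i j + κ * (y i * y j)) * α * ‖y‖ ^ 2)
      + ((α + π) * (π * kron i j + κ * (y i * y j)) - α * κ * (y i * y j)
        - α * π * kron i j - π * κ * (y i * y j)
        + π * kron i j * κ * ‖y‖ ^ 2) * (y k * y k) := by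
    intro k
    simp only [h2, Finset.sum_sub_distrib, Finset.sum_add_distrib, sum_kron_mul,
      ← Finset.mul_sum, sum_sq_eq, hself]
    rw [kron_comm j i]
    ring
  simp only [h1, h3, Finset.sum_sub_distrib, Finset.sum_add_distrib, sum_kron_mul,
    ← Finset.mul_sum, sum_sq_eq, Finset.sum_const, Finset.card_univ, Fintype.card_fin,
    nsmul_eq_mul, Nat.cast_add, Nat.cast_one]
  rw [kron_comm j i]
  ring

/-- The Ricci tensor of a warped product metric `φ(q)² dq² + ψ(q)² g_can`, `q = |y|²`. -/
lemma ricci_warped {n : ℕ} {ψ φ : ℝ → ℝ} (hψ : ContDiffOn ℝ ∞ ψ (Ioi 0))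
    (hφ : ContDiffOn ℝ ∞ φ (Ioi 0)) (hψ0 : ∀ q > 0, 0 < ψ q) (hφ0 : ∀ q > 0, 0 < φ q)
    {G : Model n → Matrix (Fin (n + 1)) (Fin (n + 1)) ℝ}
    (hG : ∀ z : Model n, z ≠ 0 → G z = Matrix.of fun i j =>
      ψ (‖z‖ ^ 2) ^ 2 / ‖z‖ ^ 2 * kron i j
        + (4 * φ (‖z‖ ^ 2) ^ 2 - ψ (‖z‖ ^ 2) ^ 2 / (‖z‖ ^ 2) ^ 2) * z i * z j)
    {y : Model n} (hy : y ≠ 0) {q ψ1 ψ2 φ1 S α : ℝ} (hq : q = ‖y‖ ^ 2) (hψ1 : ψ1 = deriv ψ q)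
    (hψ2 : ψ2 = deriv (deriv ψ) q) (hφ1 : φ1 = deriv φ q)
    (hS : S = ψ2 / φ q ^ 2 - ψ1 * φ1 / φ q ^ 3)
    (hα : α = (-(ψ q * S) + ((n : ℝ) - 1) * (1 - ψ1 ^ 2 / φ q ^ 2)) / q)
    (i j : Fin (n + 1)) :
    ricci G i j y = α * kron i j
      + (-(4 * n * q * φ q ^ 2 * S / ψ q) - α) / q * (y i * y j) := by
  have hd : ∀ f : ℝ → ℝ, ContDiffOn ℝ ∞ f (Ioi 0) →
      ContDiffOn ℝ ∞ (deriv f) (Ioi 0) ∧ ∀ q > 0, HasDerivAt f (deriv f q) q := by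
    intro f hf
    refine ⟨((contDiffOn_infty_iff_deriv_of_isOpen isOpen_Ioi).1 hf).2, fun q hq => ?_⟩
    exact ((hf.differentiableOn (by simp)).differentiableAt (Ioi_mem_nhds hq)).hasDerivAt
  obtain ⟨cψ', dψ⟩ := hd ψ hψ
  obtain ⟨-, dψ'⟩ := hd _ cψ'
  obtain ⟨cφ', dφ⟩ := hd φ hφ
  obtain ⟨-, dφ'⟩ := hd _ cφ'
  have hpos : ∀ z : Model n, z ≠ 0 → 0 < ‖z‖ ^ 2 := fun z hz => by positivity
  have hq0 : 0 < q := hq ▸ hpos y hy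
  have hΓ : ∀ z : Model n, z ≠ 0 → ∀ k i j, christoffel G k i j z =
      (fun q => 2 * deriv ψ q / ψ q - 1 / q) (‖z‖ ^ 2) * (z i * kron j k + z j * kron i k)
      + (fun q => 1 / q - ψ q * deriv ψ q / (2 * q ^ 2 * φ q ^ 2)) (‖z‖ ^ 2) * z k * kron i j
      + (fun q => 2 * deriv φ q / (q * φ q) + ψ q * deriv ψ q / (2 * q ^ 3 * φ q ^ 2)
        - 4 * deriv ψ q / (q * ψ q) + 2 / q ^ 2) (‖z‖ ^ 2) * (z i * z j * z k) := by
    intro z hz k i j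
    have hp := hpos z hz
    have p1 := hψ0 _ hp
    have p2 := hφ0 _ hp
    have ha : HasDerivAt (fun q => ψ q ^ 2 / q)
        (2 * ψ (‖z‖ ^ 2) * deriv ψ (‖z‖ ^ 2) / ‖z‖ ^ 2 - ψ (‖z‖ ^ 2) ^ 2 / (‖z‖ ^ 2) ^ 2)
        (‖z‖ ^ 2) := by
      refine (((dψ _ hp).pow 2).div (hasDerivAt_id _) hp.ne').congr_deriv ?_
      simp only [id, Pi.pow_apply]
      field_simp
      norm_num
      ring
    have hb : HasDerivAt (fun q => 4 * φ q ^ 2 - ψ q ^ 2 / q ^ 2)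
        (8 * φ (‖z‖ ^ 2) * deriv φ (‖z‖ ^ 2)
          - 2 * ψ (‖z‖ ^ 2) * deriv ψ (‖z‖ ^ 2) / (‖z‖ ^ 2) ^ 2
          + 2 * ψ (‖z‖ ^ 2) ^ 2 / (‖z‖ ^ 2) ^ 3) (‖z‖ ^ 2) := by
      refine ((((dφ _ hp).pow 2).const_mul 4).sub (((dψ _ hp).pow 2).div
        ((hasDerivAt_id (‖z‖ ^ 2)).pow 2) (by simpa using hz))).congr_deriv ?_
      simp only [id, Pi.pow_apply]
      field_simp
      norm_num
      ring
    rw [christoffel_radial (a := fun q => ψ q ^ 2 / q)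
      (b := fun q => 4 * φ q ^ 2 - ψ q ^ 2 / q ^ 2) ?_ ha hb (by positivity) ?_]
    · have e : ψ (‖z‖ ^ 2) ^ 2 / ‖z‖ ^ 2
        + (4 * φ (‖z‖ ^ 2) ^ 2 - ψ (‖z‖ ^ 2) ^ 2 / (‖z‖ ^ 2) ^ 2) * ‖z‖ ^ 2
        = 4 * ‖z‖ ^ 2 * φ (‖z‖ ^ 2) ^ 2 := by
        field_simp
        ring
      simp only [e]
      generalize ‖z‖ ^ 2 = q at *
      congr 1
      · congr 1
        · congr 1
          field_simp
        · congr 2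
          field_simp
          ring
      · congr 1
        field_simp
        ring
    · filter_upwards [isOpen_ne.mem_nhds hz] with u hu using hG u hu
    · have e : ψ (‖z‖ ^ 2) ^ 2 / ‖z‖ ^ 2
        + (4 * φ (‖z‖ ^ 2) ^ 2 - ψ (‖z‖ ^ 2) ^ 2 / (‖z‖ ^ 2) ^ 2) * ‖z‖ ^ 2
        = 4 * ‖z‖ ^ 2 * φ (‖z‖ ^ 2) ^ 2 := by
        field_simp
        ring
      rw [e]
      positivity
  have p1 := hψ0 q hq0
  have p2 := hφ0 q hq0
  have ne1 := p1.ne'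
  have ne2 := p2.ne'
  have ne3 := hq0.ne'
  have hA : HasDerivAt (fun q => 2 * deriv ψ q / ψ q - 1 / q)
      (2 * ψ2 / ψ q - 2 * ψ1 ^ 2 / ψ q ^ 2 + 1 / q ^ 2) q := by
    subst hψ1 hψ2
    refine ((((dψ' q hq0).const_mul 2).div (dψ q hq0) ne1).sub
      ((hasDerivAt_const q (1 : ℝ)).div (hasDerivAt_id q) ne3)).congr_deriv ?_
    simp only [id]
    field_simp
    ring
  have hP : HasDerivAt (fun q => 1 / q - ψ q * deriv ψ q / (2 * q ^ 2 * φ q ^ 2))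
      (-(1 / q ^ 2) - (ψ1 ^ 2 + ψ q * ψ2) / (2 * q ^ 2 * φ q ^ 2)
        + ψ q * ψ1 / (q ^ 3 * φ q ^ 2) + ψ q * ψ1 * φ1 / (q ^ 2 * φ q ^ 3)) q := by
    subst hψ1 hψ2 hφ1
    refine (((hasDerivAt_const q (1 : ℝ)).div (hasDerivAt_id q) ne3).sub
      (((dψ q hq0).mul (dψ' q hq0)).div ((((hasDerivAt_id q).pow 2).const_mul 2).mul
        ((dφ q hq0).pow 2)) (by simp [ne3, ne2]))).congr_deriv ?_
    simp only [id, Pi.pow_apply, Pi.mul_apply]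
    field_simp
    norm_num
    ring
  have hQ : HasDerivAt (fun q => 2 * deriv φ q / (q * φ q)
        + ψ q * deriv ψ q / (2 * q ^ 3 * φ q ^ 2) - 4 * deriv ψ q / (q * ψ q) + 2 / q ^ 2)
      (2 * deriv (deriv φ) q / (q * φ q) - 2 * φ1 / (q ^ 2 * φ q) - 2 * φ1 ^ 2 / (q * φ q ^ 2)
        + (ψ1 ^ 2 + ψ q * ψ2) / (2 * q ^ 3 * φ q ^ 2) - 3 * ψ q * ψ1 / (2 * q ^ 4 * φ q ^ 2)
        - ψ q * ψ1 * φ1 / (q ^ 3 * φ q ^ 3) - 4 * ψ2 / (q * ψ q) + 4 * ψ1 / (q ^ 2 * ψ q)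
        + 4 * ψ1 ^ 2 / (q * ψ q ^ 2) - 4 / q ^ 3) q := by
    subst hψ1 hψ2 hφ1
    refine ((((((dφ' q hq0).const_mul 2).div ((hasDerivAt_id q).mul (dφ q hq0))
        (by simp [ne3, ne2])).add
      (((dψ q hq0).mul (dψ' q hq0)).div ((((hasDerivAt_id q).pow 3).const_mul 2).mul
        ((dφ q hq0).pow 2)) (by simp [ne3, ne2]))).sub
      (((dψ' q hq0).const_mul 4).div ((hasDerivAt_id q).mul (dψ q hq0))
        (by simp [ne3, ne1]))).add
      ((hasDerivAt_const q (2 : ℝ)).div ((hasDerivAt_id q).pow 2)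
        (by simp [ne3]))).congr_deriv ?_
    simp only [id, Pi.pow_apply, Pi.mul_apply]
    field_simp
    norm_num
    ring
  have key := ricci_radial (G := G) (y := y) ?_ (hq ▸ hA) (hq ▸ hP) (hq ▸ hQ) i j q _ _ _ _ _
    hq rfl rfl rfl rfl rfl
  · rw [key]
    clear key hA hP hQ hΓ
    subst hα hS
    simp only [← hq, ← hψ1, ← hφ1]
    generalize ψ q = a at *
    generalize φ q = b at *
    congr 1
    · congr 1
      field_simp
      ring
    · congr 1
      field_simp
      ring
  · filter_upwards [isOpen_ne.mem_nhds hy] with z hz using hΓ z hz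

/-! ### Calculus for the maximum principle -/

/-- If a continuous family of functions on a compact set is positive initially but not always,
there is a first time at which it touches zero. -/
lemma exists_first_zero {X : Type*} [TopologicalSpace X] {K : Set X} (hK : IsCompact K)
    {a b : ℝ} {f : ℝ → X → ℝ}
    (hf : ContinuousOn (fun p : ℝ × X => f p.1 p.2) (Icc a b ×ˢ K))
    (ha : ∀ x ∈ K, 0 < f a x) {t : ℝ} (ht : t ∈ Icc a b) {x₁ : X} (hx₁ : x₁ ∈ K)
    (h : f t x₁ ≤ 0) :
    ∃ τ ∈ Ioc a b, ∃ x ∈ K, f τ x = 0 ∧ (∀ y ∈ K, 0 ≤ f τ y) ∧ ∀ s ∈ Icc a τ, 0 ≤ f s x := by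
  have hc : IsCompact (Icc a b ×ˢ K) := isCompact_Icc.prod hK
  have hS : IsCompact {p ∈ Icc a b ×ˢ K | f p.1 p.2 ≤ 0} := by
    obtain ⟨u, hu, hu'⟩ := (continuousOn_iff_isClosed.1 hf) (Iic 0) isClosed_Iic
    have : {p ∈ Icc a b ×ˢ K | f p.1 p.2 ≤ 0} = (Icc a b ×ˢ K) ∩ u := by
      rw [inter_comm, ← hu']
      ext p
      simp [and_comm]
    rw [this]
    exact hc.inter_right hu
  obtain ⟨⟨τ, x⟩, ⟨⟨hτ, hx⟩, hle⟩, hmin⟩ :=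
    hS.exists_isMinOn ⟨(t, x₁), ⟨ht, hx₁⟩, h⟩ continuous_fst.continuousOn
  simp only at hτ hx hle
  have hpos : ∀ s ∈ Ico a τ, ∀ y ∈ K, 0 < f s y := by
    intro s hs y hy
    by_contra hcon
    have := isMinOn_iff.1 hmin (s, y) ⟨⟨⟨hs.1, hs.2.le.trans hτ.2⟩, hy⟩, not_lt.1 hcon⟩
    exact absurd hs.2 (not_lt.2 this)
  have haτ : a < τ := by
    refine lt_of_le_of_ne hτ.1 fun e => ?_
    subst e
    exact absurd (ha x hx) (not_lt.2 hle)
  have hnn : ∀ y ∈ K, 0 ≤ f τ y := by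
    intro y hy
    have h1 : ContinuousOn (fun s => f s y) (Icc a b) :=
      hf.comp (f := fun s => (s, y)) (by fun_prop) fun s hs => ⟨hs, hy⟩
    have h2 : Tendsto (fun s => f s y) (𝓝[Ico a τ] τ) (𝓝 (f τ y)) :=
      (h1 τ hτ).mono_left (nhdsWithin_mono _ fun s hs => ⟨hs.1, hs.2.le.trans hτ.2⟩)
    have : (𝓝[Ico a τ] τ).NeBot := by
      rw [← mem_closure_iff_nhdsWithin_neBot, closure_Ico haτ.ne]
      exact ⟨haτ.le, le_rfl⟩
    refine ge_of_tendsto h2 ?_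
    filter_upwards [self_mem_nhdsWithin] with s hs using (hpos s hs y hy).le
  refine ⟨τ, ⟨haτ, hτ.2⟩, x, hx, le_antisymm hle (hnn x hx), hnn, fun s hs => ?_⟩
  rcases hs.2.lt_or_eq with h' | h'
  · exact (hpos s ⟨hs.1, h'⟩ x hx).le
  · rw [h']; exact hnn x hx

lemma deriv_nonpos_of_nonneg_left {f : ℝ → ℝ} {f' a τ : ℝ} (haτ : a < τ)
    (hf : HasDerivAt f f' τ) (h0 : f τ = 0) (h : ∀ s ∈ Icc a τ, 0 ≤ f s) : f' ≤ 0 := by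
  have h1 : Tendsto (slope f τ) (𝓝[<] τ) (𝓝 f') :=
    (hasDerivAt_iff_tendsto_slope.1 hf).mono_left
      (nhdsWithin_mono _ fun _ hx => (mem_Iio.1 hx).ne)
  refine le_of_tendsto h1 ?_
  filter_upwards [Ioo_mem_nhdsLT haτ] with s hs
  rw [slope_def_field, h0, sub_zero]
  exact div_nonpos_of_nonneg_of_nonpos (h s ⟨hs.1.le, hs.2.le⟩) (by linarith [hs.2])

lemma IsLocalMin.deriv_deriv_nonneg {f : ℝ → ℝ} {x : ℝ} (h : IsLocalMin f x)
    (hf : ContinuousAt f x) : 0 ≤ deriv (deriv f) x := by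
  by_contra hneg
  have hmax := isLocalMax_of_deriv_deriv_neg (not_le.1 hneg) h.deriv_eq_zero hf
  have hc : f =ᶠ[𝓝 x] fun _ => f x := by
    filter_upwards [h, hmax] with y h1 h2 using le_antisymm h2 h1
  have : deriv (deriv f) x = 0 := by
    rw [hc.deriv.deriv_eq]
    simp
  exact hneg this.ge

lemma IsLocalMax.deriv_deriv_nonpos {f : ℝ → ℝ} {x : ℝ} (h : IsLocalMax f x)
    (hf : ContinuousAt f x) : deriv (deriv f) x ≤ 0 := by
  have := IsLocalMin.deriv_deriv_nonneg h.neg hf.neg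
  have e : deriv (fun y => - f y) = fun y => - deriv f y := by
    ext y
    exact deriv.fun_neg
  rw [e, deriv.fun_neg] at this
  linarith

section TwoVariables

variable {f : ℝ → ℝ → ℝ} {Ω : Set (ℝ × ℝ)}

lemma hasDerivAt_snd (hΩ : IsOpen Ω)
    (hf : ContDiffOn ℝ ∞ (fun p : ℝ × ℝ => f p.1 p.2) Ω) {t q : ℝ} (h : (t, q) ∈ Ω) :
    HasDerivAt (f t) (fderiv ℝ (fun p : ℝ × ℝ => f p.1 p.2) (t, q) (0, 1)) q := by
  have h1 := ((hf.differentiableOn (by simp)).differentiableAt (hΩ.mem_nhds h)).hasFDerivAt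
  have h2 : HasDerivAt (fun x : ℝ => (t, x)) ((0 : ℝ), (1 : ℝ)) q :=
    (hasDerivAt_const q t).prodMk (hasDerivAt_id q)
  exact h1.comp_hasDerivAt q h2

lemma hasDerivAt_fst (hΩ : IsOpen Ω)
    (hf : ContDiffOn ℝ ∞ (fun p : ℝ × ℝ => f p.1 p.2) Ω) {t q : ℝ} (h : (t, q) ∈ Ω) :
    HasDerivAt (fun s => f s q) (fderiv ℝ (fun p : ℝ × ℝ => f p.1 p.2) (t, q) (1, 0)) t := by
  have h1 := ((hf.differentiableOn (by simp)).differentiableAt (hΩ.mem_nhds h)).hasFDerivAt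
  have h2 : HasDerivAt (fun x : ℝ => (x, q)) ((1 : ℝ), (0 : ℝ)) t :=
    (hasDerivAt_id t).prodMk (hasDerivAt_const t q)
  exact h1.comp_hasDerivAt t h2

lemma contDiffOn_deriv_snd (hΩ : IsOpen Ω)
    (hf : ContDiffOn ℝ ∞ (fun p : ℝ × ℝ => f p.1 p.2) Ω) :
    ContDiffOn ℝ ∞ (fun p : ℝ × ℝ => deriv (f p.1) p.2) Ω := by
  have h1 : ContDiffOn ℝ ∞ (fun p => fderiv ℝ (fun p : ℝ × ℝ => f p.1 p.2) p (0, 1)) Ω :=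
    (hf.fderiv_of_isOpen hΩ (m := ∞) (by simp)).clm_apply contDiffOn_const
  exact h1.congr fun p hp => (hasDerivAt_snd hΩ hf hp).deriv

/-- Partial derivatives of a smooth function commute. -/
lemma hasDerivAt_deriv_comm (hΩ : IsOpen Ω)
    (hf : ContDiffOn ℝ ∞ (fun p : ℝ × ℝ => f p.1 p.2) Ω) {t q : ℝ} (h : (t, q) ∈ Ω) :
    HasDerivAt (fun s => deriv (f s) q) (deriv (fun x => deriv (fun s => f s x) t) q) t := by
  set F := fun p : ℝ × ℝ => f p.1 p.2 with hF
  have hat : ContDiffAt ℝ ∞ F (t, q) := hf.contDiffAt (hΩ.mem_nhds h)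
  have hd : HasFDerivAt (fderiv ℝ F) (fderiv ℝ (fderiv ℝ F) (t, q)) (t, q) :=
    ((hat.fderiv_right (m := ∞) (by simp)).differentiableAt (by simp)).hasFDerivAt
  have hsymm : IsSymmSndFDerivAt ℝ F (t, q) := hat.isSymmSndFDerivAt <| by
    simpa using (mod_cast le_top : ((2 : ℕ∞) : WithTop ℕ∞) ≤ ((⊤ : ℕ∞) : WithTop ℕ∞))
  have h1 : HasDerivAt (fun s => fderiv ℝ F (s, q) (0, 1))
      (fderiv ℝ (fderiv ℝ F) (t, q) (1, 0) (0, 1)) t := by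
    have h2 : HasDerivAt (fun x : ℝ => (x, q)) ((1 : ℝ), (0 : ℝ)) t :=
      (hasDerivAt_id t).prodMk (hasDerivAt_const t q)
    have h3 := hd.comp_hasDerivAt t h2
    exact ((ContinuousLinearMap.apply ℝ ℝ ((0, 1) : ℝ × ℝ)).hasFDerivAt).comp_hasDerivAt t h3
  have h1' : HasDerivAt (fun x => fderiv ℝ F (t, x) (1, 0))
      (fderiv ℝ (fderiv ℝ F) (t, q) (0, 1) (1, 0)) q := by
    have h2 : HasDerivAt (fun x : ℝ => (t, x)) ((0 : ℝ), (1 : ℝ)) q :=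
      (hasDerivAt_const q t).prodMk (hasDerivAt_id q)
    have h3 := hd.comp_hasDerivAt q h2
    exact ((ContinuousLinearMap.apply ℝ ℝ ((1, 0) : ℝ × ℝ)).hasFDerivAt).comp_hasDerivAt q h3
  have e1 : (fun s => deriv (f s) q) =ᶠ[𝓝 t] fun s => fderiv ℝ F (s, q) (0, 1) := by
    have hc : ContinuousAt (fun s : ℝ => (s, q)) t := by fun_prop
    filter_upwards [hc.preimage_mem_nhds (hΩ.mem_nhds h)] with s hs
    exact (hasDerivAt_snd hΩ hf hs).deriv
  have e2 : (fun x => deriv (fun s => f s x) t) =ᶠ[𝓝 q] fun x => fderiv ℝ F (t, x) (1, 0) := by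
    have hc : ContinuousAt (fun x : ℝ => (t, x)) q := by fun_prop
    filter_upwards [hc.preimage_mem_nhds (hΩ.mem_nhds h)] with s hs
    exact (hasDerivAt_fst hΩ hf hs).deriv
  rw [e2.deriv_eq, h1'.deriv, ← hsymm.eq]
  exact h1.congr_of_eventuallyEq e1

end TwoVariables

/-! ### Ricci flow of warped products -/

/-- The derivative `∂ψ/∂s` with respect to arclength. -/
def arcSlope (ψ φ : ℝ → ℝ → ℝ) (t q : ℝ) : ℝ := deriv (ψ t) q / φ t q

/-- The metrics `φ(t,q)² dq² + ψ(t,q)² g_can` on `(0,∞) × S^n` evolve by Ricci flow. -/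
structure IsWarpedFlow (n : ℕ) (T : ℝ) (ψ φ : ℝ → ℝ → ℝ) : Prop where
  smooth_radius : ContDiffOn ℝ ∞ (fun p : ℝ × ℝ => ψ p.1 p.2) (Ioo 0 T ×ˢ Ioi 0)
  smooth_speed : ContDiffOn ℝ ∞ (fun p : ℝ × ℝ => φ p.1 p.2) (Ioo 0 T ×ˢ Ioi 0)
  radius_pos : ∀ t ∈ Ioo 0 T, ∀ q > 0, 0 < ψ t q
  speed_pos : ∀ t ∈ Ioo 0 T, ∀ q > 0, 0 < φ t q
  radius_evol : ∀ t ∈ Ioo 0 T, ∀ q > 0, HasDerivAt (fun s => ψ s q)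
    (deriv (arcSlope ψ φ t) q / φ t q
      - ((n : ℝ) - 1) * (1 - arcSlope ψ φ t q ^ 2) / ψ t q) t
  speed_evol : ∀ t ∈ Ioo 0 T, ∀ q > 0, HasDerivAt (fun s => φ s q)
    (n * deriv (arcSlope ψ φ t) q / ψ t q) t

namespace IsWarpedFlow

variable {n : ℕ} {T : ℝ} {ψ φ : ℝ → ℝ → ℝ}

lemma isOpen_domain : IsOpen (Ioo 0 T ×ˢ Ioi (0 : ℝ)) := isOpen_Ioo.prod isOpen_Ioi

lemma smooth_arcSlope (h : IsWarpedFlow n T ψ φ) :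
    ContDiffOn ℝ ∞ (fun p : ℝ × ℝ => arcSlope ψ φ p.1 p.2) (Ioo 0 T ×ˢ Ioi 0) :=
  (contDiffOn_deriv_snd isOpen_domain h.smooth_radius).div h.smooth_speed
    fun p hp => ne_of_gt (h.speed_pos p.1 hp.1 p.2 hp.2)

/-- Evolution equation of `ψ_s`. -/
lemma arcSlope_evol (h : IsWarpedFlow n T ψ φ) {t q : ℝ} (ht : t ∈ Ioo 0 T) (hq : 0 < q)
    {w w1 w2 : ℝ} (hw : w = arcSlope ψ φ t q) (hw1 : w1 = deriv (arcSlope ψ φ t) q)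
    (hw2 : w2 = deriv (deriv (arcSlope ψ φ t)) q) :
    HasDerivAt (fun s => arcSlope ψ φ s q)
      ((w2 / φ t q - w1 * deriv (φ t) q / φ t q ^ 2) / φ t q
        + ((n : ℝ) - 2) * w * w1 / (φ t q * ψ t q)
        + ((n : ℝ) - 1) * (1 - w ^ 2) * w / ψ t q ^ 2) t := by
  have hm : (t, q) ∈ Ioo 0 T ×ˢ Ioi (0 : ℝ) := ⟨ht, hq⟩
  have p1 := (h.radius_pos t ht q hq).ne'
  have p2 := (h.speed_pos t ht q hq).ne'
  have cw := h.smooth_arcSlope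
  have cw1 := contDiffOn_deriv_snd isOpen_domain cw
  have dw : HasDerivAt (arcSlope ψ φ t) w1 q := hw1 ▸
    (hasDerivAt_snd isOpen_domain cw hm).differentiableAt.hasDerivAt
  have dw1 : HasDerivAt (deriv (arcSlope ψ φ t)) w2 q := hw2 ▸
    (hasDerivAt_snd isOpen_domain (f := fun s => deriv (arcSlope ψ φ s)) cw1
      hm).differentiableAt.hasDerivAt
  have dφ : HasDerivAt (φ t) (deriv (φ t) q) q :=
    (hasDerivAt_snd isOpen_domain h.smooth_speed hm).differentiableAt.hasDerivAt
  have dψ : HasDerivAt (ψ t) (φ t q * w) q := by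
    have := (hasDerivAt_snd isOpen_domain h.smooth_radius hm).differentiableAt.hasDerivAt
    refine this.congr_deriv ?_
    rw [hw, arcSlope]
    field_simp
  have e : (fun x => deriv (fun s => ψ s x) t) =ᶠ[𝓝 q] fun x =>
      deriv (arcSlope ψ φ t) x / φ t x
        - ((n : ℝ) - 1) * (1 - arcSlope ψ φ t x ^ 2) / ψ t x := by
    filter_upwards [Ioi_mem_nhds hq] with x hx
    exact (h.radius_evol t ht x hx).deriv
  have d1 := hasDerivAt_deriv_comm isOpen_domain h.smooth_radius hm
  have d2 := ((dw1.div dφ p2).sub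
    ((((dw.pow 2).const_sub 1).const_mul ((n : ℝ) - 1)).div dψ p1))
  rw [e.deriv_eq] at d1
  erw [d2.deriv] at d1
  refine (d1.div (h.speed_evol t ht q hq) p2).congr_deriv ?_
  have e3 : deriv (ψ t) q = φ t q * w := dψ.deriv
  simp only [Pi.pow_apply, ← hw, ← hw1, e3]
  field_simp
  norm_num
  ring

end IsWarpedFlow

namespace IsWarpedFlow

variable {n : ℕ} {T : ℝ} {ψ φ : ℝ → ℝ → ℝ}

lemma deriv_arcSlope_of_critical (h : IsWarpedFlow n T ψ φ) {t q : ℝ} (ht : t ∈ Ioo 0 T)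
    (hq : 0 < q) (hc : deriv (ψ t) q = 0) :
    deriv (arcSlope ψ φ t) q = deriv (deriv (ψ t)) q / φ t q := by
  have hm : (t, q) ∈ Ioo 0 T ×ˢ Ioi (0 : ℝ) := ⟨ht, hq⟩
  have p2 := (h.speed_pos t ht q hq).ne'
  have dψ' : HasDerivAt (deriv (ψ t)) (deriv (deriv (ψ t)) q) q :=
    (hasDerivAt_snd isOpen_domain (f := fun s => deriv (ψ s))
      (contDiffOn_deriv_snd isOpen_domain h.smooth_radius) hm).differentiableAt.hasDerivAt
  have dφ : HasDerivAt (φ t) (deriv (φ t) q) q :=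
    (hasDerivAt_snd isOpen_domain h.smooth_speed hm).differentiableAt.hasDerivAt
  have := (dψ'.div dφ p2).deriv
  change deriv (fun q => deriv (ψ t) q / φ t q) q = _
  erw [this]
  rw [hc]
  field_simp
  ring

lemma continuousAt_radius (h : IsWarpedFlow n T ψ φ) {t q : ℝ} (ht : t ∈ Ioo 0 T)
    (hq : 0 < q) : ContinuousAt (ψ t) q :=
  (hasDerivAt_snd isOpen_domain h.smooth_radius (Set.mk_mem_prod ht hq)).continuousAt

/-- The radius stays monotone towards an end at which it tends to zero. -/
theorem radius_antitone (h : IsWarpedFlow n T ψ φ) {q₀ T' : ℝ} (hq₀ : 0 < q₀) (hT : T' ≤ T)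
    (hsmall : ∀ ε > 0, ∃ q₁, ∀ q ≥ q₁, ∀ t ∈ Ioo 0 T', ψ t q < ε)
    (hbdry : ∀ t ∈ Ioo 0 T', ∀ y ≥ q₀, ψ t y ≤ ψ t q₀)
    (hstart : ∀ ε > 0, ∀ q₁, ∀ᶠ t in 𝓝[>] (0 : ℝ), ∀ x ∈ Icc q₀ q₁, ∀ y ∈ Icc x q₁,
      ψ t y ^ 2 < ψ t x ^ 2 + ε)
    {t x y : ℝ} (ht : t ∈ Ioo 0 T') (hx : q₀ ≤ x) (hxy : x ≤ y) : ψ t y ≤ ψ t x := by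
  by_contra hcon
  rw [not_le] at hcon
  have sub : ∀ s ∈ Ioc 0 t, s ∈ Ioo 0 T := fun s hs => ⟨hs.1, by linarith [hs.2, ht.2]⟩
  have sub' : ∀ s ∈ Ioc 0 t, s ∈ Ioo 0 T' := fun s hs => ⟨hs.1, by linarith [hs.2, ht.2]⟩
  have hx0 : 0 < ψ t x := h.radius_pos t (sub t ⟨ht.1, le_rfl⟩) x (hq₀.trans_le hx)
  obtain ⟨ε, hε, hεt⟩ : ∃ ε > 0, ψ t x ^ 2 - ψ t y ^ 2 + ε * (1 + t) ≤ 0 := by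
    refine ⟨(ψ t y ^ 2 - ψ t x ^ 2) / (1 + t), div_pos (by nlinarith) (by linarith [ht.1]), ?_⟩
    rw [div_mul_cancel₀ _ (by linarith [ht.1])]
    linarith
  obtain ⟨q₁, hq₁⟩ := hsmall (Real.sqrt ε) (Real.sqrt_pos.2 hε)
  set Y := max q₁ y with hY
  obtain ⟨a, ha, hat⟩ := ((hstart ε hε Y).and (Ioo_mem_nhdsGT ht.1)).exists
  set K : Set (ℝ × ℝ) := {p | p.1 ∈ Icc q₀ Y ∧ p.2 ∈ Icc q₀ Y ∧ p.1 ≤ p.2} with hKdef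
  have hK : IsCompact K := by
    have : K = (Icc q₀ Y ×ˢ Icc q₀ Y) ∩ {p | p.1 ≤ p.2} := by
      ext p
      simp only [hKdef, mem_ofPred_eq, mem_inter_iff, mem_prod, and_assoc]
    rw [this]
    exact (isCompact_Icc.prod isCompact_Icc).inter_right
      (isClosed_le continuous_fst continuous_snd)
  let Z : ℝ → ℝ × ℝ → ℝ := fun s z => ψ s z.1 ^ 2 - ψ s z.2 ^ 2 + ε * (1 + s)
  have hc : ContinuousOn (fun p : ℝ × ℝ × ℝ => Z p.1 p.2)
      (Icc a t ×ˢ K) := by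
    have c0 := h.smooth_radius.continuousOn
    have c1 : ContinuousOn (fun p : ℝ × ℝ × ℝ => ψ p.1 p.2.1) (Icc a t ×ˢ K) :=
      c0.comp (f := fun p : ℝ × ℝ × ℝ => (p.1, p.2.1)) (by fun_prop) fun p hp =>
        ⟨sub _ ⟨hat.1.trans_le hp.1.1, hp.1.2⟩, hq₀.trans_le hp.2.1.1⟩
    have c2 : ContinuousOn (fun p : ℝ × ℝ × ℝ => ψ p.1 p.2.2) (Icc a t ×ˢ K) :=
      c0.comp (f := fun p : ℝ × ℝ × ℝ => (p.1, p.2.2)) (by fun_prop) fun p hp =>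
        ⟨sub _ ⟨hat.1.trans_le hp.1.1, hp.1.2⟩, hq₀.trans_le hp.2.2.1.1⟩
    exact ((c1.pow 2).sub (c2.pow 2)).add (by fun_prop)
  obtain ⟨τ, hτ, ⟨x', y'⟩, ⟨hx', hy', hxy'⟩, hz, hmin, hleft⟩ := exists_first_zero (f := Z) hK hc
    (fun z hz => by
      have := ha z.1 hz.1 z.2 ⟨hz.2.2, hz.2.1.2⟩
      have : 0 < ε * a := mul_pos hε hat.1
      simp only [Z]
      linarith) (t := t) ⟨hat.2.le, le_rfl⟩
    (x₁ := (x, y)) ⟨⟨hx, hxy.trans (le_max_right _ _)⟩,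
      ⟨hx.trans hxy, le_max_right _ _⟩, hxy⟩ hεt
  simp only [Z] at hx' hy' hxy' hz hmin hleft
  have hτ0 : 0 < τ := hat.1.trans hτ.1
  have hτm := sub τ ⟨hτ0, hτ.2⟩
  have hετ : 0 < ε * τ := mul_pos hε hτ0
  have px' : 0 < x' := hq₀.trans_le hx'.1
  have py' : 0 < y' := hq₀.trans_le hy'.1
  have ne1 : x' ≠ y' := by
    rintro rfl
    linarith
  have ne2 : y' ≠ Y := by
    intro e
    have h1 := hq₁ y' (e ▸ le_max_left _ _) τ (sub' τ ⟨hτ0, hτ.2⟩)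
    have h2 := h.radius_pos τ hτm y' py'
    have h3 : ψ τ y' ^ 2 < ε := by
      rw [← Real.sq_sqrt hε.le]
      gcongr
    nlinarith [sq_nonneg (ψ τ x')]
  have ne3 : x' ≠ q₀ := by
    intro e
    have h1 := hbdry τ (sub' τ ⟨hτ0, hτ.2⟩) y' hy'.1
    have h2 := h.radius_pos τ hτm y' py'
    rw [e] at hz
    nlinarith
  have lt1 : x' < y' := lt_of_le_of_ne hxy' ne1
  have lt2 : y' < Y := lt_of_le_of_ne hy'.2 ne2
  have lt3 : q₀ < x' := lt_of_le_of_ne hx'.1 (Ne.symm ne3)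
  have locmin : IsLocalMin (ψ τ) x' := by
    filter_upwards [Ioo_mem_nhds lt3 lt1] with u hu
    have := hmin (u, y') ⟨⟨hu.1.le, (hu.2.trans lt2).le⟩, hy', hu.2.le⟩
    simp only at this
    have hu0 := h.radius_pos τ hτm u (hq₀.trans hu.1)
    exact (pow_le_pow_iff_left₀ (h.radius_pos τ hτm x' px').le hu0.le two_ne_zero).1
      (by linarith)
  have locmax : IsLocalMax (ψ τ) y' := by
    filter_upwards [Ioo_mem_nhds lt1 lt2] with u hu
    have := hmin (x', u) ⟨hx', ⟨(lt3.trans hu.1).le, hu.2.le⟩, hu.1.le⟩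
    simp only at this
    have hu0 := h.radius_pos τ hτm u (px'.trans hu.1)
    exact (pow_le_pow_iff_left₀ hu0.le (h.radius_pos τ hτm y' py').le two_ne_zero).1
      (by linarith)
  have hd := ((((h.radius_evol τ hτm x' px').pow 2).sub
    ((h.radius_evol τ hτm y' py').pow 2)).add
    (((hasDerivAt_id τ).const_add 1).const_mul ε))
  have hle := deriv_nonpos_of_nonneg_left hτ.1 hd hz hleft
  have cx := locmin.deriv_eq_zero
  have cy := locmax.deriv_eq_zero
  have sx : arcSlope ψ φ τ x' = 0 := by simp [arcSlope, cx]
  have sy : arcSlope ψ φ τ y' = 0 := by simp [arcSlope, cy]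
  rw [h.deriv_arcSlope_of_critical hτm px' cx, h.deriv_arcSlope_of_critical hτm py' cy,
    sx, sy] at hle
  have h1 := IsLocalMin.deriv_deriv_nonneg locmin (h.continuousAt_radius hτm px')
  have h2 := IsLocalMax.deriv_deriv_nonpos locmax (h.continuousAt_radius hτm py')
  have p1 := h.radius_pos τ hτm x' px'
  have p2 := h.speed_pos τ hτm x' px'
  have p3 := h.radius_pos τ hτm y' py'
  have p4 := h.speed_pos τ hτm y' py'
  have e1 : ∀ ψ S : ℝ, 0 < ψ → 2 * ψ * (S - ((n : ℝ) - 1) * (1 - 0 ^ 2) / ψ)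
      = 2 * ψ * S - 2 * ((n : ℝ) - 1) := by
    intro ψ S hψ
    field_simp
    ring
  have k1 : 0 ≤ 2 * ψ τ x' * (deriv (deriv (ψ τ)) x' / φ τ x' / φ τ x') := by positivity
  have k2 : 2 * ψ τ y' * (deriv (deriv (ψ τ)) y' / φ τ y' / φ τ y') ≤ 0 :=
    mul_nonpos_of_nonneg_of_nonpos (by positivity)
      (div_nonpos_of_nonpos_of_nonneg (div_nonpos_of_nonpos_of_nonneg h2 p4.le) p4.le)
  simp only [Nat.cast_ofNat, Nat.add_one_sub_one, pow_one, e1 _ _ p1, e1 _ _ p3, mul_one] at hle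
  linarith

/-- At a point where `ψ_s² - A (ψ - δ)` has a spatial minimum with value zero, it increases. -/
lemma barrier_deriv_pos (h : IsWarpedFlow n T ψ φ) (hn : 2 ≤ n) {A δ t q d : ℝ} (hA : 0 < A)
    (hA' : A ≤ 1 / 2) (hδ : 0 < δ) (ht : t ∈ Ioo 0 T) (hq : 0 < q) (hlt : ψ t q < 1)
    (hmono : ∀ᶠ x in 𝓝 q, arcSlope ψ φ t x ≤ 0)
    (hzero : arcSlope ψ φ t q ^ 2 - A * (ψ t q - δ) = 0)
    (hmin : IsLocalMin (fun x => arcSlope ψ φ t x ^ 2 - A * (ψ t x - δ)) q)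
    (hd : HasDerivAt (fun s => arcSlope ψ φ s q ^ 2 - A * (ψ s q - δ)) d t) : 0 < d := by
  have hm : (t, q) ∈ Ioo 0 T ×ˢ Ioi (0 : ℝ) := ⟨ht, hq⟩
  have p1 := h.radius_pos t ht q hq
  have p2 := h.speed_pos t ht q hq
  have cw := h.smooth_arcSlope
  have cw1 := contDiffOn_deriv_snd isOpen_domain cw
  have dw : ∀ x > 0, HasDerivAt (arcSlope ψ φ t) (deriv (arcSlope ψ φ t) x) x := fun x hx =>
    (hasDerivAt_snd isOpen_domain cw (Set.mk_mem_prod ht hx)).differentiableAt.hasDerivAt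
  have dw1 : HasDerivAt (deriv (arcSlope ψ φ t)) (deriv (deriv (arcSlope ψ φ t)) q) q :=
    (hasDerivAt_snd isOpen_domain (f := fun s => deriv (arcSlope ψ φ s)) cw1
      hm).differentiableAt.hasDerivAt
  have dφ : HasDerivAt (φ t) (deriv (φ t) q) q :=
    (hasDerivAt_snd isOpen_domain h.smooth_speed hm).differentiableAt.hasDerivAt
  have dψ : ∀ x > 0, HasDerivAt (ψ t) (φ t x * arcSlope ψ φ t x) x := by
    intro x hx
    have := (hasDerivAt_snd isOpen_domain h.smooth_radius
      (Set.mk_mem_prod ht hx)).differentiableAt.hasDerivAt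
    refine this.congr_deriv ?_
    have := (h.speed_pos t ht x hx).ne'
    rw [arcSlope]
    field_simp
  have dQ : ∀ x > 0, HasDerivAt (fun x => arcSlope ψ φ t x ^ 2 - A * (ψ t x - δ))
      (2 * arcSlope ψ φ t x * deriv (arcSlope ψ φ t) x - A * (φ t x * arcSlope ψ φ t x)) x := by
    intro x hx
    refine (((dw x hx).pow 2).sub (((dψ x hx).sub_const δ).const_mul A)).congr_deriv ?_
    norm_num
  have hcrit := hmin.deriv_eq_zero
  have hsnd := IsLocalMin.deriv_deriv_nonneg hmin (dQ q hq).continuousAt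
  have e : deriv (fun x => arcSlope ψ φ t x ^ 2 - A * (ψ t x - δ)) =ᶠ[𝓝 q] fun x =>
      2 * arcSlope ψ φ t x * deriv (arcSlope ψ φ t) x - A * (φ t x * arcSlope ψ φ t x) := by
    filter_upwards [Ioi_mem_nhds hq] with x hx using (dQ x hx).deriv
  have dQ' := (((dw q hq).const_mul 2).mul dw1).sub ((dφ.mul (dw q hq)).const_mul A)
  rw [(dQ q hq).deriv] at hcrit
  rw [e.deriv_eq] at hsnd
  erw [dQ'.deriv] at hsnd
  have hd' := ((h.arcSlope_evol ht hq rfl rfl rfl).pow 2).sub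
    (((h.radius_evol t ht q hq).sub_const δ).const_mul A)
  rw [hd.unique hd']
  have hmax : arcSlope ψ φ t q = 0 → deriv (arcSlope ψ φ t) q = 0 := by
    intro h0
    refine IsLocalMax.deriv_eq_zero (f := arcSlope ψ φ t) ?_
    filter_upwards [hmono] with x hx
    rw [h0]
    exact hx
  clear hd hd' dQ' e dQ dψ dφ dw1 dw cw1 cw hmin hmono
  have hn' : (2 : ℝ) ≤ n := by exact_mod_cast hn
  generalize arcSlope ψ φ t q = w at *
  generalize deriv (arcSlope ψ φ t) q = w1 at *
  generalize deriv (deriv (arcSlope ψ φ t)) q = w2 at *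
  generalize deriv (φ t) q = φ1 at *
  generalize ψ t q = r at *
  generalize φ t q = u at *
  simp only [Nat.cast_ofNat, Nat.add_one_sub_one, pow_one]
  by_cases hw : w = 0
  · rw [hw, hmax hw]
    have : 0 < A * (((n : ℝ) - 1) / r) := mul_pos hA (div_pos (by linarith) p1)
    convert this using 1
    ring
  · have hw1 : w1 = A * u / 2 := by
      have : w * (2 * w1 - A * u) = 0 := by linarith
      rcases mul_eq_zero.1 this with h' | h'
      · exact absurd h' hw
      · linarith
    have hww : 0 ≤ w * (w2 - A * φ1 / 2) := by
      rw [hw1] at hsnd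
      nlinarith
    have hw2 : w ^ 2 ≤ 1 / 2 := by nlinarith
    have e : 2 * w * ((w2 / u - w1 * φ1 / u ^ 2) / u + ((n : ℝ) - 2) * w * w1 / (u * r)
          + ((n : ℝ) - 1) * (1 - w ^ 2) * w / r ^ 2)
        - A * (w1 / u - ((n : ℝ) - 1) * (1 - w ^ 2) / r) =
        2 * (w * (w2 - A * φ1 / 2)) / u ^ 2 + ((n : ℝ) - 2) * A * w ^ 2 / r
          + 2 * ((n : ℝ) - 1) * (1 - w ^ 2) * w ^ 2 / r ^ 2
          + A * (((n : ℝ) - 1) * (1 - w ^ 2) / r - A / 2) := by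
      rw [hw1]
      field_simp
      ring
    rw [e]
    have k0 : (0 : ℝ) ≤ n - 2 := by linarith
    have k0' : (0 : ℝ) ≤ n - 1 := by linarith
    have k0'' : 0 ≤ 1 - w ^ 2 := by linarith
    have k1 : 0 ≤ 2 * (w * (w2 - A * φ1 / 2)) / u ^ 2 := by positivity
    have k2 : 0 ≤ ((n : ℝ) - 2) * A * w ^ 2 / r := by positivity
    have k3 : 0 ≤ 2 * ((n : ℝ) - 1) * (1 - w ^ 2) * w ^ 2 / r ^ 2 := by positivity
    have k4 : 1 / 2 ≤ ((n : ℝ) - 1) * (1 - w ^ 2) / r := by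
      rw [le_div_iff₀ p1]
      nlinarith
    have k5 : 0 < A * (((n : ℝ) - 1) * (1 - w ^ 2) / r - A / 2) := mul_pos hA (by linarith)
    linarith

/-- The lower barrier `ψ_s² ≥ A ψ` persists near an end at which the radius tends to zero. -/
theorem le_arcSlope_sq (h : IsWarpedFlow n T ψ φ) (hn : 2 ≤ n) {q₀ T' A : ℝ} (hq₀ : 0 < q₀)
    (hT : T' ≤ T) (hA : 0 < A) (hA' : A ≤ 1 / 2)
    (hsmall : ∀ ε > 0, ∃ q₁, ∀ q ≥ q₁, ∀ t ∈ Ioo 0 T', ψ t q < ε)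
    (hmono : ∀ t ∈ Ioo 0 T', ∀ q > q₀, arcSlope ψ φ t q ≤ 0)
    (hlt : ∀ t ∈ Ioo 0 T', ∀ q ≥ q₀, ψ t q < 1)
    (hbdry : ∀ t ∈ Ioo 0 T', A * ψ t q₀ ≤ arcSlope ψ φ t q₀ ^ 2)
    (hstart : ∀ δ > 0, ∀ q₁, ∀ᶠ t in 𝓝[>] (0 : ℝ), ∀ q ∈ Icc q₀ q₁,
      A * (ψ t q - δ) < arcSlope ψ φ t q ^ 2)
    {t q : ℝ} (ht : t ∈ Ioo 0 T') (hq : q₀ ≤ q) : A * ψ t q ≤ arcSlope ψ φ t q ^ 2 := by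
  by_contra hcon
  rw [not_le] at hcon
  have sub : ∀ s ∈ Ioc 0 t, s ∈ Ioo 0 T := fun s hs => ⟨hs.1, by linarith [hs.2, ht.2]⟩
  have sub' : ∀ s ∈ Ioc 0 t, s ∈ Ioo 0 T' := fun s hs => ⟨hs.1, by linarith [hs.2, ht.2]⟩
  obtain ⟨δ, hδ, hδt⟩ : ∃ δ > 0, arcSlope ψ φ t q ^ 2 - A * (ψ t q - δ) ≤ 0 := by
    refine ⟨(A * ψ t q - arcSlope ψ φ t q ^ 2) / A, div_pos (by linarith) hA, ?_⟩
    field_simp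
    linarith
  obtain ⟨q₁, hq₁⟩ := hsmall δ hδ
  set Y := max q₁ q with hY
  obtain ⟨a, ha, hat⟩ := ((hstart δ hδ Y).and (Ioo_mem_nhdsGT ht.1)).exists
  let Q : ℝ → ℝ → ℝ := fun s x => arcSlope ψ φ s x ^ 2 - A * (ψ s x - δ)
  have hc : ContinuousOn (fun p : ℝ × ℝ => Q p.1 p.2) (Icc a t ×ˢ Icc q₀ Y) := by
    have hsub : Icc a t ×ˢ Icc q₀ Y ⊆ Ioo 0 T ×ˢ Ioi (0 : ℝ) := fun p hp =>
      ⟨sub _ ⟨hat.1.trans_le hp.1.1, hp.1.2⟩, hq₀.trans_le hp.2.1⟩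
    exact ((h.smooth_arcSlope.continuousOn.mono hsub).pow 2).sub
      (continuousOn_const.mul ((h.smooth_radius.continuousOn.mono hsub).sub continuousOn_const))
  obtain ⟨τ, hτ, x, hx, hz, hmin, hleft⟩ := exists_first_zero (f := Q) isCompact_Icc hc
    (fun z hz => by
      have := ha z hz
      simp only [Q]
      linarith) (t := t) ⟨hat.2.le, le_rfl⟩ (x₁ := q) ⟨hq, le_max_right _ _⟩ hδt
  simp only [Q] at hz hmin hleft
  have hτ0 : 0 < τ := hat.1.trans hτ.1
  have hτm := sub τ ⟨hτ0, hτ.2⟩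
  have hτm' := sub' τ ⟨hτ0, hτ.2⟩
  have ne1 : x ≠ Y := by
    intro e
    have h1 := hq₁ x (e ▸ le_max_left _ _) τ hτm'
    nlinarith [sq_nonneg (arcSlope ψ φ τ x)]
  have ne2 : x ≠ q₀ := by
    intro e
    have h1 := hbdry τ hτm'
    rw [e] at hz
    nlinarith
  have lt1 : x < Y := lt_of_le_of_ne hx.2 ne1
  have lt2 : q₀ < x := lt_of_le_of_ne hx.1 (Ne.symm ne2)
  have px : 0 < x := hq₀.trans lt2
  have hm : (τ, x) ∈ Ioo 0 T ×ˢ Ioi (0 : ℝ) := ⟨hτm, px⟩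
  have hd := ((hasDerivAt_fst isOpen_domain h.smooth_arcSlope hm).pow 2).sub
    (((hasDerivAt_fst isOpen_domain h.smooth_radius hm).sub_const δ).const_mul A)
  have hle := deriv_nonpos_of_nonneg_left hτ.1 hd hz hleft
  refine absurd hle (not_le.2 (h.barrier_deriv_pos hn hA hA' hδ hτm px (hlt τ hτm' x hx.1)
    ?_ hz ?_ hd))
  · filter_upwards [Ioi_mem_nhds lt2] with u hu using hmono τ hτm' u hu
  · filter_upwards [Ioo_mem_nhds lt2 lt1] with u hu
    rw [hz]
    exact hmin u ⟨hu.1.le, hu.2.le⟩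

/-- Under the barrier `ψ_s² ≥ A ψ`, the length of a radial segment is controlled by the radius
at its outer end. -/
lemma integral_speed_le (h : IsWarpedFlow n T ψ φ) {t A a b : ℝ} (ht : t ∈ Ioo 0 T)
    (hA : 0 < A) (ha : 0 < a) (hab : a ≤ b)
    (hmono : ∀ q ∈ Icc a b, arcSlope ψ φ t q ≤ 0)
    (hbar : ∀ q ∈ Icc a b, A * ψ t q ≤ arcSlope ψ φ t q ^ 2) :
    ∫ q in a..b, φ t q ≤ 2 / Real.sqrt A * Real.sqrt (ψ t a) := by
  have hpos : ∀ q ∈ Icc a b, 0 < q := fun q hq => ha.trans_le hq.1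
  have hcφ : ContinuousOn (φ t) (Icc a b) :=
    h.smooth_speed.continuousOn.comp (f := fun q => (t, q)) (by fun_prop)
      fun q hq => ⟨ht, hpos q hq⟩
  have hder : ∀ q ∈ Icc a b, HasDerivAt (fun q => -(2 / Real.sqrt A * Real.sqrt (ψ t q)))
      (-(2 / Real.sqrt A * (φ t q * arcSlope ψ φ t q / (2 * Real.sqrt (ψ t q))))) q := by
    intro q hq
    have h1 := (hasDerivAt_snd isOpen_domain h.smooth_radius
      (Set.mk_mem_prod ht (hpos q hq))).differentiableAt.hasDerivAt
    have h2 : deriv (ψ t) q = φ t q * arcSlope ψ φ t q := by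
      have := (h.speed_pos t ht q (hpos q hq)).ne'
      rw [arcSlope]
      field_simp
    rw [h2] at h1
    exact ((h1.sqrt (h.radius_pos t ht q (hpos q hq)).ne').const_mul _).neg
  have hle := intervalIntegral.integral_le_sub_of_hasDeriv_right_of_le (φ := φ t) hab
    (fun q hq => (hder q hq).continuousAt.continuousWithinAt)
    (fun q hq => (hder q (Ioo_subset_Icc_self hq)).hasDerivWithinAt)
    hcφ.integrableOn_Icc ?_
  · refine hle.trans ?_
    have : 0 ≤ 2 / Real.sqrt A * Real.sqrt (ψ t b) := by positivity
    linarith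
  · intro q hq
    have hq' := Ioo_subset_Icc_self hq
    have p1 := h.radius_pos t ht q (hpos q hq')
    have p2 := h.speed_pos t ht q (hpos q hq')
    have hs : Real.sqrt A * Real.sqrt (ψ t q) ≤ -arcSlope ψ φ t q := by
      rw [← Real.sqrt_mul hA.le]
      refine Real.sqrt_le_iff.2 ⟨by linarith [hmono q hq'], ?_⟩
      rw [neg_sq]
      exact hbar q hq'
    have s1 := Real.sqrt_pos.2 hA
    have s2 := Real.sqrt_pos.2 p1
    have e : -(2 / Real.sqrt A * (φ t q * arcSlope ψ φ t q / (2 * Real.sqrt (ψ t q)))) =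
        φ t q * (-arcSlope ψ φ t q) / (Real.sqrt A * Real.sqrt (ψ t q)) := by
      field_simp
    rw [e, le_div_iff₀ (by positivity)]
    gcongr

end IsWarpedFlow

/-! ### Stereographic charts -/

instance (n : ℕ) : ContinuousSMul ℝ (Ambient n) :=
  @IsBoundedSMul.continuousSMul ℝ (Ambient n) _ _ _ _ _ NormedSpace.toIsBoundedSMul

/-- Both stereographic parametrizations: `ε = 1` for `stereoN`, `ε = -1` for `stereoS`. -/
def stereo (n : ℕ) (ε : ℝ) (y : Model n) : Ambient n :=
  WithLp.toLp 2 ((2 / (‖y‖ ^ 2 + 1)) • y, ε * ((‖y‖ ^ 2 - 1) / (‖y‖ ^ 2 + 1)))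

lemma stereoN_eq (n : ℕ) : stereoN n = stereo n 1 := by
  ext y
  simp [stereoN, stereo]

lemma stereoS_eq (n : ℕ) : stereoS n = stereo n (-1) := by
  funext y
  simp only [stereoS, stereo]
  congr 2
  ring

lemma contDiff_stereo (n : ℕ) (ε : ℝ) : ContDiff ℝ ∞ (stereo n ε) := by
  have h : ContDiff ℝ ∞ fun y : Model n =>
      ((2 / (‖y‖ ^ 2 + 1)) • y, ε * ((‖y‖ ^ 2 - 1) / (‖y‖ ^ 2 + 1))) := by
    have h1 : ContDiff ℝ ∞ fun y : Model n => ‖y‖ ^ 2 := contDiff_norm_sq ℝ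
    have h2 : ∀ y : Model n, ‖y‖ ^ 2 + 1 ≠ 0 := fun y => by positivity
    exact ((contDiff_const.div (h1.add contDiff_const) h2).smul contDiff_id).prodMk
      (contDiff_const.mul ((h1.sub contDiff_const).div (h1.add contDiff_const) h2))
  exact (WithLp.prodContinuousLinearEquiv 2 ℝ (Model n) ℝ).symm.contDiff.comp h

lemma hasFDerivAt_stereo (n : ℕ) (ε : ℝ) (y : Model n) :
    HasFDerivAt (stereo n ε) (fderiv ℝ (stereo n ε) y) y :=
  ((contDiff_stereo n ε).differentiable (by simp) y).hasFDerivAt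

lemma norm_stereo {n : ℕ} {ε : ℝ} (hε : ε ^ 2 = 1) (y : Model n) : ‖stereo n ε y‖ = 1 := by
  have h : ‖stereo n ε y‖ ^ 2 = 1 := by
    rw [WithLp.prod_norm_sq_eq_of_L2]
    have : (‖y‖ ^ 2 + 1) ≠ 0 := by positivity
    change ‖(2 / (‖y‖ ^ 2 + 1)) • y‖ ^ 2
      + ‖ε * ((‖y‖ ^ 2 - 1) / (‖y‖ ^ 2 + 1))‖ ^ 2 = 1
    rw [norm_smul, Real.norm_eq_abs, Real.norm_eq_abs, mul_pow, sq_abs, sq_abs, mul_pow, hε]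
    field_simp
    ring
  nlinarith [norm_nonneg (stereo n ε y)]

lemma inner_stereo_fderiv {n : ℕ} {ε : ℝ} (hε : ε ^ 2 = 1) (y u : Model n) :
    inner ℝ (stereo n ε y) (fderiv ℝ (stereo n ε) y u) = 0 := by
  have h := (hasFDerivAt_stereo n ε y).norm_sq
  have h' : HasFDerivAt (fun y => ‖stereo n ε y‖ ^ 2) (0 : Model n →L[ℝ] ℝ) y := by
    simp only [norm_stereo hε, one_pow]
    exact hasFDerivAt_const _ _
  have := congrArg (fun L : Model n →L[ℝ] ℝ => L u) (h.unique h')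
  simp at this
  simp
  linarith

/-- `rotate R` as a continuous linear map. -/
def rotateL {n : ℕ} (R : Model n ≃ₗᵢ[ℝ] Model n) : Ambient n →L[ℝ] Ambient n :=
  ((WithLp.prodContinuousLinearEquiv 2 ℝ (Model n) ℝ).symm : _ →L[ℝ] Ambient n) ∘L
    ((R.toContinuousLinearEquiv : Model n →L[ℝ] Model n).prodMap
      (ContinuousLinearMap.id ℝ ℝ)) ∘L
    (WithLp.prodContinuousLinearEquiv 2 ℝ (Model n) ℝ : Ambient n →L[ℝ] _)

lemma rotateL_apply {n : ℕ} (R : Model n ≃ₗᵢ[ℝ] Model n) (p : Ambient n) :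
    rotateL R p = rotate R p := rfl

lemma stereo_rotate {n : ℕ} {ε : ℝ} (R : Model n ≃ₗᵢ[ℝ] Model n) (y : Model n) :
    stereo n ε (R y) = rotate R (stereo n ε y) := by
  simp [stereo, rotate]

lemma fderiv_stereo_rotate {n : ℕ} {ε : ℝ} (R : Model n ≃ₗᵢ[ℝ] Model n) (y u : Model n) :
    fderiv ℝ (stereo n ε) (R y) (R u) = rotate R (fderiv ℝ (stereo n ε) y u) := by
  have h1 : HasFDerivAt (stereo n ε ∘ R)
      ((fderiv ℝ (stereo n ε) (R y)) ∘L (R.toContinuousLinearEquiv : Model n →L[ℝ] Model n))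
      y := by
    refine HasFDerivAt.comp y (hasFDerivAt_stereo n ε (R y)) ?_
    exact R.toContinuousLinearEquiv.hasFDerivAt
  have h2 : HasFDerivAt (stereo n ε ∘ R) (rotateL R ∘L fderiv ℝ (stereo n ε) y) y := by
    have : stereo n ε ∘ R = rotateL R ∘ stereo n ε := by
      funext y
      rw [Function.comp_apply, Function.comp_apply, stereo_rotate, rotateL_apply]
    rw [this]
    exact (rotateL R).hasFDerivAt.comp y (hasFDerivAt_stereo n ε y)
  have e : (fderiv ℝ (stereo n ε) (R y)) ∘L
      (R.toContinuousLinearEquiv : Model n →L[ℝ] Model n) =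
      rotateL R ∘L fderiv ℝ (stereo n ε) y := h1.unique h2
  rw [← rotateL_apply, ← ContinuousLinearMap.comp_apply (rotateL R), ← e]
  rfl

/-! ### Rotations -/

section Rotations

variable {n : ℕ}

lemma norm_coordVec (i : Fin (n + 1)) : ‖coordVec n i‖ = 1 := by simp [coordVec]

lemma inner_coordVec_coordVec (i j : Fin (n + 1)) :
    inner ℝ (coordVec n i) (coordVec n j) = kron i j := by
  rw [inner_coordVec, coordVec_apply, kron_comm]

lemma coordVec_ne_zero (i : Fin (n + 1)) : coordVec n i ≠ 0 := by
  rw [← norm_ne_zero_iff, norm_coordVec]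
  exact one_ne_zero

/-- Orientation preserving isometries. -/
def IsRotation (R : Model n ≃ₗᵢ[ℝ] Model n) : Prop :=
  LinearMap.det (R.toLinearEquiv : Model n →ₗ[ℝ] Model n) = 1

/-- The reflection in the hyperplane orthogonal to `v`. -/
def hyperRefl (v : Model n) : Model n ≃ₗᵢ[ℝ] Model n := (Submodule.span ℝ {v})ᗮ.reflection

lemma det_hyperRefl {v : Model n} (hv : v ≠ 0) :
    LinearMap.det ((hyperRefl v).toLinearEquiv : Model n →ₗ[ℝ] Model n) = -1 := by
  have := Submodule.det_reflection (𝕜 := ℝ) (Submodule.span ℝ {v})ᗮ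
  rw [Submodule.orthogonal_orthogonal, finrank_span_singleton hv, pow_one] at this
  exact this

lemma hyperRefl_of_orthogonal {v u : Model n} (h : inner ℝ v u = 0) : hyperRefl v u = u :=
  Submodule.reflection_mem_subspace_eq_self (Submodule.mem_orthogonal_singleton_iff_inner_right.2 h)

lemma hyperRefl_self (v : Model n) : hyperRefl v v = -v :=
  Submodule.reflection_orthogonalComplement_singleton_eq_neg v

lemma hyperRefl_sub {v w : Model n} (h : ‖v‖ = ‖w‖) : hyperRefl (v - w) v = w := by
  rw [hyperRefl]
  exact Submodule.reflection_sub h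

lemma hyperRefl_hyperRefl (v u : Model n) : hyperRefl v (hyperRefl v u) = u := by
  rw [hyperRefl]
  exact Submodule.reflection_reflection _ _

lemma isRotation_trans {v w : Model n} (hv : v ≠ 0) (hw : w ≠ 0) :
    IsRotation ((hyperRefl v).trans (hyperRefl w)) := by
  have : (((hyperRefl v).trans (hyperRefl w)).toLinearEquiv : Model n →ₗ[ℝ] Model n) =
      ((hyperRefl w).toLinearEquiv : Model n →ₗ[ℝ] Model n) ∘ₗ
        ((hyperRefl v).toLinearEquiv : Model n →ₗ[ℝ] Model n) := rfl
  rw [IsRotation, this, LinearMap.det_comp, det_hyperRefl hv, det_hyperRefl hw]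
  norm_num

/-- The quarter turn in the plane of two coordinate vectors. -/
lemma exists_quarter_turn {i j : Fin (n + 1)} (hij : i ≠ j) :
    ∃ R : Model n ≃ₗᵢ[ℝ] Model n, IsRotation R ∧ R (coordVec n i) = coordVec n j ∧
      R (coordVec n j) = -coordVec n i ∧
      ∀ k, k ≠ i → k ≠ j → R (coordVec n k) = coordVec n k := by
  have hne : coordVec n i - coordVec n j ≠ 0 := by
    intro h
    have := congrArg (fun v : Model n => v i) h
    simp [coordVec_apply, kron, hij] at this
  have hn : ‖coordVec n i‖ = ‖coordVec n j‖ := by simp [norm_coordVec]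
  have s1 : hyperRefl (coordVec n i - coordVec n j) (coordVec n i) = coordVec n j :=
    hyperRefl_sub hn
  have s2 : hyperRefl (coordVec n i - coordVec n j) (coordVec n j) = coordVec n i := by
    have := hyperRefl_hyperRefl (coordVec n i - coordVec n j) (coordVec n i)
    rwa [s1] at this
  refine ⟨(hyperRefl (coordVec n i - coordVec n j)).trans (hyperRefl (coordVec n i)),
    isRotation_trans hne (coordVec_ne_zero i), ?_, ?_, ?_⟩
  · rw [LinearIsometryEquiv.trans_apply, s1]
    exact hyperRefl_of_orthogonal (by simp [inner_coordVec_coordVec, kron, hij])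
  · rw [LinearIsometryEquiv.trans_apply, s2, hyperRefl_self]
  · intro k hki hkj
    have h1 : hyperRefl (coordVec n i - coordVec n j) (coordVec n k) = coordVec n k :=
      hyperRefl_of_orthogonal
        (by simp [inner_sub_left, inner_coordVec_coordVec, kron, hki.symm, hkj.symm])
    rw [LinearIsometryEquiv.trans_apply, h1]
    exact hyperRefl_of_orthogonal (by simp [inner_coordVec_coordVec, kron, hki.symm])

/-- Every vector is the image of a multiple of the first coordinate vector. -/
lemma exists_rotation_axis (hn : 1 ≤ n) (z : Model n) :
    ∃ R : Model n ≃ₗᵢ[ℝ] Model n, IsRotation R ∧ R (‖z‖ • coordVec n 0) = z := by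
  by_cases h : ‖z‖ • coordVec n 0 - z = 0
  · refine ⟨LinearIsometryEquiv.refl ℝ _, ?_, sub_eq_zero.1 h⟩
    rw [IsRotation]
    exact LinearMap.det_id
  · have hl : (0 : Fin (n + 1)) ≠ Fin.last n := by
      simp [Fin.ext_iff]
      omega
    refine ⟨(hyperRefl (coordVec n (Fin.last n))).trans
      (hyperRefl (‖z‖ • coordVec n 0 - z)), isRotation_trans (coordVec_ne_zero _) h, ?_⟩
    have h1 : hyperRefl (coordVec n (Fin.last n)) (‖z‖ • coordVec n 0) = ‖z‖ • coordVec n 0 :=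
      hyperRefl_of_orthogonal (by simp [inner_smul_right, inner_coordVec_coordVec, kron, hl.symm])
    rw [LinearIsometryEquiv.trans_apply, h1]
    exact hyperRefl_sub (by simp [norm_smul, norm_coordVec])

end Rotations

/-! ### Coefficients of rotationally symmetric metrics -/

section Coefficients

variable {n : ℕ} {M : Set (Ambient n)} {g : FormField n} {ε : ℝ}

/-- The bilinear form of `g` in the parametrization `σ`. -/
def chartForm (g : FormField n) (σ : Model n → Ambient n) (y : Model n) :
    Model n →L[ℝ] Model n →L[ℝ] ℝ :=
  (g (σ y)).bilinearComp (fderiv ℝ σ y) (fderiv ℝ σ y)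

lemma coeff_eq_chartForm (g : FormField n) (σ : Model n → Ambient n) (y : Model n)
    (i j : Fin (n + 1)) :
    coeff g σ y i j = chartForm g σ y (coordVec n i) (coordVec n j) := rfl

lemma chartForm_rotate (hsym : IsRotationallySymmetric M g) (hε : ε ^ 2 = 1)
    {R : Model n ≃ₗᵢ[ℝ] Model n} (hR : IsRotation R) {y : Model n} (hy : stereo n ε y ∈ M)
    (u w : Model n) :
    chartForm g (stereo n ε) (R y) (R u) (R w) = chartForm g (stereo n ε) y u w := by
  have := hsym R hR (stereo n ε y) hy (fderiv ℝ (stereo n ε) y u) (fderiv ℝ (stereo n ε) y w)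
    (inner_stereo_fderiv hε y u) (inner_stereo_fderiv hε y w)
  rw [← stereo_rotate, ← fderiv_stereo_rotate, ← fderiv_stereo_rotate] at this
  exact this

lemma sum_smul_coordVec (u : Model n) : ∑ i, u i • coordVec n i = u := by
  ext j
  simp [coordVec_apply, kron]

lemma bilinear_eq_of_axis {B : Model n →L[ℝ] Model n →L[ℝ] ℝ} {a b : ℝ}
    (h : ∀ i j, B (coordVec n i) (coordVec n j) = a * kron i j + b * kron i 0 * kron j 0)
    (u w : Model n) : B u w = a * inner ℝ u w + b * u 0 * w 0 := by
  have h1 : B u w = ∑ i, ∑ j, u i * (w j * B (coordVec n i) (coordVec n j)) := by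
    conv_lhs => rw [← sum_smul_coordVec u, ← sum_smul_coordVec w]
    simp only [map_sum, map_smul, sum_apply, smul_apply,
      smul_eq_mul]
    simp only [Finset.mul_sum]
    rw [Finset.sum_comm]
    refine Finset.sum_congr rfl fun i _ => Finset.sum_congr rfl fun j _ => ?_
    ring
  rw [h1]
  have h2 : inner ℝ u w = ∑ i, u i * w i := by
    rw [PiLp.inner_apply]
    exact Finset.sum_congr rfl fun i _ => by simp [mul_comm]
  rw [h2]
  have h3 : ∀ i j, u i * (w j * (a * kron i j + b * kron i 0 * kron j 0)) =
      kron i j * (a * (u i * w j)) + kron 0 j * (kron 0 i * (b * u i * w j)) := by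
    intro i j
    rw [kron_comm i 0, kron_comm j 0]
    ring
  simp only [h, h3, Finset.sum_add_distrib, sum_kron_mul, ← Finset.mul_sum]

lemma zero_ne_last (hn : 1 ≤ n) : (0 : Fin (n + 1)) ≠ Fin.last n := by
  simp [Fin.ext_iff]
  omega

/-- On the axis, the coefficients are diagonal. -/
lemma coeff_axis (hn : 2 ≤ n) (hsym : IsRotationallySymmetric M g) (hε : ε ^ 2 = 1) {ρ : ℝ}
    (hM : stereo n ε (ρ • coordVec n 0) ∈ M)
    (hG : ∀ i j, coeff g (stereo n ε) (ρ • coordVec n 0) i j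
      = coeff g (stereo n ε) (ρ • coordVec n 0) j i) (i j : Fin (n + 1)) :
    coeff g (stereo n ε) (ρ • coordVec n 0) i j =
      coeff g (stereo n ε) (ρ • coordVec n 0) (Fin.last n) (Fin.last n) * kron i j
      + (coeff g (stereo n ε) (ρ • coordVec n 0) 0 0
        - coeff g (stereo n ε) (ρ • coordVec n 0) (Fin.last n) (Fin.last n))
        * kron i 0 * kron j 0 := by
  set B := chartForm g (stereo n ε) (ρ • coordVec n 0) with hB
  have hinv : ∀ R : Model n ≃ₗᵢ[ℝ] Model n, IsRotation R → R (coordVec n 0) = coordVec n 0 →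
      ∀ u w, B (R u) (R w) = B u w := by
    intro R hR h0 u w
    have := chartForm_rotate hsym hε hR hM u w
    rwa [map_smul, h0] at this
  simp only [coeff_eq_chartForm, ← hB] at hG ⊢
  have hdiag : ∀ i j, i ≠ 0 → j ≠ 0 → i ≠ j →
      B (coordVec n i) (coordVec n i) = B (coordVec n j) (coordVec n j) ∧
      B (coordVec n i) (coordVec n j) = 0 ∧ B (coordVec n 0) (coordVec n i) = 0 := by
    intro i j hi hj hij
    obtain ⟨R, hR, h1, h2, h3⟩ := exists_quarter_turn hij
    have h0 := h3 0 hi.symm hj.symm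
    have k := hinv R hR h0
    refine ⟨?_, ?_, ?_⟩
    · rw [← k (coordVec n i), h1]
    · have := k (coordVec n i) (coordVec n j)
      rw [h1, h2, map_neg, hG j i] at this
      linarith
    · have e1 := k (coordVec n 0) (coordVec n i)
      have e2 := k (coordVec n 0) (coordVec n j)
      rw [h0, h1] at e1
      rw [h0, h2, map_neg] at e2
      linarith
  have hl := (zero_ne_last (by omega : 1 ≤ n)).symm
  have hother : ∀ i : Fin (n + 1), i ≠ 0 → ∃ j, j ≠ 0 ∧ i ≠ j := by
    intro i hi
    by_cases h : i = Fin.last n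
    · refine ⟨⟨1, by omega⟩, by simp [Fin.ext_iff], ?_⟩
      rw [h]
      simp [Fin.ext_iff]
      omega
    · exact ⟨Fin.last n, hl, h⟩
  have hz : ∀ i, i ≠ 0 → B (coordVec n 0) (coordVec n i) = 0 := by
    intro i hi
    obtain ⟨j, hj, hij⟩ := hother i hi
    exact (hdiag i j hi hj hij).2.2
  by_cases hi : i = 0
  · by_cases hj : j = 0
    · simp [hi, hj, kron]
    · simp [hi, hj, kron, hz j hj, Ne.symm hj]
  · by_cases hj : j = 0
    · rw [hG, hj, hz i hi]
      simp [hi, kron]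
    · by_cases hij : i = j
      · subst hij
        by_cases hil : i = Fin.last n
        · subst hil
          simp [kron, hi]
        · rw [(hdiag i (Fin.last n) hi hl hil).1]
          simp [kron, hi]
      · rw [(hdiag i j hi hj hij).2.1]
        simp [kron, hi, hij]

lemma coeff_radial (hn : 2 ≤ n) (hsym : IsRotationallySymmetric M g) (hε : ε ^ 2 = 1)
    {z : Model n} (hz : z ≠ 0) (hM : stereo n ε (‖z‖ • coordVec n 0) ∈ M)
    (hG : ∀ i j, coeff g (stereo n ε) (‖z‖ • coordVec n 0) i j
      = coeff g (stereo n ε) (‖z‖ • coordVec n 0) j i) (i j : Fin (n + 1)) :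
    coeff g (stereo n ε) z i j =
      coeff g (stereo n ε) (‖z‖ • coordVec n 0) (Fin.last n) (Fin.last n) * kron i j
      + (coeff g (stereo n ε) (‖z‖ • coordVec n 0) 0 0
        - coeff g (stereo n ε) (‖z‖ • coordVec n 0) (Fin.last n) (Fin.last n)) / ‖z‖ ^ 2
        * z i * z j := by
  obtain ⟨R, hR, hRz⟩ := exists_rotation_axis (by omega : 1 ≤ n) z
  have h1 := bilinear_eq_of_axis
    (B := chartForm g (stereo n ε) (‖z‖ • coordVec n 0)) (coeff_axis hn hsym hε hM hG)
    (R.symm (coordVec n i)) (R.symm (coordVec n j))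
  have h2 := chartForm_rotate hsym hε hR hM (R.symm (coordVec n i)) (R.symm (coordVec n j))
  rw [hRz, R.apply_symm_apply, R.apply_symm_apply] at h2
  have hnz : ‖z‖ ≠ 0 := norm_ne_zero_iff.2 hz
  have h3 : ∀ k, R.symm (coordVec n k) 0 = z k / ‖z‖ := by
    intro k
    have : inner ℝ (R.symm (coordVec n k)) (R.symm z) = z k := by
      rw [R.symm.inner_map_map, real_inner_comm, inner_coordVec]
    have e : R.symm z = ‖z‖ • coordVec n 0 := by rw [← hRz, R.symm_apply_apply, hRz]
    rw [e, inner_smul_right, inner_coordVec] at this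
    rw [eq_div_iff hnz, mul_comm]
    exact this
  rw [h3, h3, R.symm.inner_map_map, inner_coordVec_coordVec] at h1
  rw [coeff_eq_chartForm, h2]
  refine h1.trans ?_
  field_simp

/-- At the pole the coefficients of a rotationally symmetric metric are isotropic. -/
lemma coeff_pole (hn : 1 ≤ n) (hsym : IsRotationallySymmetric M g) (hε : ε ^ 2 = 1)
    (hM : stereo n ε 0 ∈ M) :
    coeff g (stereo n ε) 0 0 0 = coeff g (stereo n ε) 0 (Fin.last n) (Fin.last n) := by
  obtain ⟨R, hR, h1, -, -⟩ := exists_quarter_turn (zero_ne_last hn)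
  have := chartForm_rotate hsym hε hR hM (coordVec n 0) (coordVec n 0)
  rw [map_zero, h1] at this
  exact this.symm

end Coefficients

/-! ### The meridian in stereographic coordinates -/

section Meridian

variable {n : ℕ} {ε : ℝ}

/-- The height of the orbit at stereographic radius `ρ`. -/
def height (ε ρ : ℝ) : ℝ := ε * ((ρ ^ 2 - 1) / (ρ ^ 2 + 1))

lemma one_sub_height_sq (hε : ε ^ 2 = 1) {ρ : ℝ} (hρ : 0 ≤ ρ) :
    Real.sqrt (1 - height ε ρ ^ 2) = 2 * ρ / (ρ ^ 2 + 1) := by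
  have : 1 - height ε ρ ^ 2 = (2 * ρ / (ρ ^ 2 + 1)) ^ 2 := by
    rw [height, mul_pow, hε]
    field_simp
    ring
  rw [this, Real.sqrt_sq (by positivity)]

lemma stereo_axis (hε : ε ^ 2 = 1) {ρ : ℝ} (hρ : 0 ≤ ρ) :
    stereo n ε (ρ • coordVec n 0) = meridian n (height ε ρ) := by
  rw [meridian, one_sub_height_sq hε hρ, stereo, norm_smul, norm_coordVec, mul_one,
    Real.norm_eq_abs, sq_abs, height, smul_smul]
  congr 3
  ring

lemma hasDerivAt_height (ε ρ : ℝ) :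
    HasDerivAt (height ε) (ε * (4 * ρ / (ρ ^ 2 + 1) ^ 2)) ρ := by
  have h : ρ ^ 2 + 1 ≠ 0 := by positivity
  refine ((((hasDerivAt_pow 2 ρ).sub_const 1).div ((hasDerivAt_pow 2 ρ).add_const 1)
    h).const_mul ε).congr_deriv ?_
  field_simp
  norm_num
  ring

lemma height_mem (hε : ε ^ 2 = 1) {ρ : ℝ} (hρ : 0 < ρ) : height ε ρ ∈ Ioo (-1 : ℝ) 1 := by
  have h := one_sub_height_sq hε hρ.le
  have : 0 < 1 - height ε ρ ^ 2 := Real.sqrt_pos.1 (h ▸ by positivity)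
  exact ⟨by nlinarith, by nlinarith⟩

lemma differentiableAt_meridian {x : ℝ} (hx : x ∈ Ioo (-1 : ℝ) 1) :
    DifferentiableAt ℝ (meridian n) x := by
  have h0 : 1 - x ^ 2 ≠ 0 := by nlinarith [hx.1, hx.2]
  have h : DifferentiableAt ℝ
      (fun x : ℝ => (Real.sqrt (1 - x ^ 2) • coordVec n 0, x)) x := by
    refine DifferentiableAt.prodMk (DifferentiableAt.smul_const ?_ _) differentiableAt_id
    exact DifferentiableAt.sqrt (by fun_prop) h0
  exact ((WithLp.prodContinuousLinearEquiv 2 ℝ (Model n) ℝ).symm.differentiableAt).comp x h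

lemma hasDerivAt_stereo_axis (n : ℕ) (ε ρ : ℝ) :
    HasDerivAt (fun r : ℝ => stereo n ε (r • coordVec n 0))
      (fderiv ℝ (stereo n ε) (ρ • coordVec n 0) (coordVec n 0)) ρ := by
  have h1 : HasDerivAt (fun r : ℝ => r • coordVec n 0) (coordVec n 0) ρ := by
    simpa using (hasDerivAt_id ρ).smul_const (coordVec n 0)
  exact (hasFDerivAt_stereo n ε (ρ • coordVec n 0)).comp_hasDerivAt ρ h1

lemma fderiv_stereo_axis (hε : ε ^ 2 = 1) {ρ : ℝ} (hρ : 0 < ρ) :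
    fderiv ℝ (stereo n ε) (ρ • coordVec n 0) (coordVec n 0) =
      (ε * (4 * ρ / (ρ ^ 2 + 1) ^ 2)) • deriv (meridian n) (height ε ρ) := by
  have h1 := hasDerivAt_stereo_axis n ε ρ
  have h2 := (differentiableAt_meridian (n := n) (height_mem hε hρ)).hasDerivAt.scomp ρ
    (hasDerivAt_height ε ρ)
  refine h1.unique (h2.congr_of_eventuallyEq ?_)
  filter_upwards [Ioi_mem_nhds hρ] with r hr
  exact stereo_axis hε (le_of_lt hr)

lemma fderiv_stereo_last (hn : 1 ≤ n) (ε ρ : ℝ) :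
    fderiv ℝ (stereo n ε) (ρ • coordVec n 0) (coordVec n (Fin.last n)) =
      WithLp.toLp 2 ((2 / (ρ ^ 2 + 1)) • coordVec n (Fin.last n), 0) := by
  have h1 : HasDerivAt (fun r : ℝ => ρ • coordVec n 0 + r • coordVec n (Fin.last n))
      (coordVec n (Fin.last n)) 0 := by
    simpa using ((hasDerivAt_id (0 : ℝ)).smul_const (coordVec n (Fin.last n))).const_add
      (ρ • coordVec n 0)
  have h2 : HasDerivAt (fun r : ℝ => stereo n ε (ρ • coordVec n 0 + r • coordVec n (Fin.last n)))
      (fderiv ℝ (stereo n ε) (ρ • coordVec n 0) (coordVec n (Fin.last n))) 0 := by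
    have h3 := hasFDerivAt_stereo n ε (ρ • coordVec n 0)
    have h4 : ρ • coordVec n 0 = ρ • coordVec n 0 + (0 : ℝ) • coordVec n (Fin.last n) := by simp
    rw [h4] at h3
    have := h3.comp_hasDerivAt (0 : ℝ) h1
    rwa [← h4] at this
  have hnorm : ∀ r : ℝ, ‖ρ • coordVec n 0 + r • coordVec n (Fin.last n)‖ ^ 2
      = ρ ^ 2 + r ^ 2 := by
    intro r
    rw [norm_add_sq_real]
    simp [norm_smul, norm_coordVec, inner_smul_left, inner_smul_right, inner_coordVec_coordVec,
      kron, zero_ne_last hn]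
  have d0 : ρ ^ 2 + (0 : ℝ) ^ 2 + 1 ≠ 0 := by positivity
  have dn : HasDerivAt (fun r : ℝ => ρ ^ 2 + r ^ 2) 0 0 := by
    simpa using (hasDerivAt_pow 2 (0 : ℝ)).const_add (ρ ^ 2)
  have k1 : HasDerivAt (fun r : ℝ => 2 / (ρ ^ 2 + r ^ 2 + 1)) 0 0 := by
    exact ((hasDerivAt_const (0 : ℝ) (2 : ℝ)).div (dn.add_const 1) d0).congr_deriv (by simp)
  have k2 : HasDerivAt (fun r : ℝ => ε * ((ρ ^ 2 + r ^ 2 - 1) / (ρ ^ 2 + r ^ 2 + 1))) 0 0 := by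
    exact (((dn.sub_const 1).div (dn.add_const 1) d0).const_mul ε).congr_deriv (by simp)
  have k3 : HasDerivAt (fun r : ℝ => (2 / (ρ ^ 2 + r ^ 2 + 1)) •
      (ρ • coordVec n 0 + r • coordVec n (Fin.last n)))
      ((2 / (ρ ^ 2 + 1)) • coordVec n (Fin.last n)) 0 := by
    exact (k1.smul h1).congr_deriv (by simp)
  have k4 := ((WithLp.prodContinuousLinearEquiv 2 ℝ (Model n) ℝ).symm.hasFDerivAt).comp_hasDerivAt
    (0 : ℝ) (k3.prodMk k2)
  refine h2.unique (k4.congr_of_eventuallyEq (Eventually.of_forall fun r => ?_))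
  simp only [stereo, hnorm]
  rfl

lemma orbitRadius_eq (hn : 1 ≤ n) (hε : ε ^ 2 = 1) (g : FormField n) {ρ : ℝ} (hρ : 0 ≤ ρ) :
    orbitRadius g (height ε ρ) = Real.sqrt
      (ρ ^ 2 * coeff g (stereo n ε) (ρ • coordVec n 0) (Fin.last n) (Fin.last n)) := by
  have hw : WithLp.toLp 2 (Real.sqrt (1 - height ε ρ ^ 2) • coordVec n (Fin.last n), (0 : ℝ)) =
      ρ • fderiv ℝ (stereo n ε) (ρ • coordVec n 0) (coordVec n (Fin.last n)) := by
    have e : (2 * ρ / (ρ ^ 2 + 1)) • coordVec n (Fin.last n) =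
        ρ • (2 / (ρ ^ 2 + 1)) • coordVec n (Fin.last n) := by
      rw [smul_smul]
      congr 1
      ring
    rw [fderiv_stereo_last hn, one_sub_height_sq hε hρ, e]
    change _ = WithLp.toLp 2 (ρ • ((2 / (ρ ^ 2 + 1)) • coordVec n (Fin.last n), (0 : ℝ)))
    rw [Prod.smul_mk, smul_zero]
  have hc : coeff g (stereo n ε) (ρ • coordVec n 0) (Fin.last n) (Fin.last n) =
      g (stereo n ε (ρ • coordVec n 0))
        (fderiv ℝ (stereo n ε) (ρ • coordVec n 0) (coordVec n (Fin.last n)))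
        (fderiv ℝ (stereo n ε) (ρ • coordVec n 0) (coordVec n (Fin.last n))) := rfl
  rw [hc]
  change Real.sqrt (g (meridian n (height ε ρ))
    (WithLp.toLp 2 (Real.sqrt (1 - height ε ρ ^ 2) • coordVec n (Fin.last n), (0 : ℝ)))
    (WithLp.toLp 2 (Real.sqrt (1 - height ε ρ ^ 2) • coordVec n (Fin.last n), (0 : ℝ)))) = _
  rw [hw, ← stereo_axis hε hρ, map_smul, map_smul, smul_apply, smul_eq_mul,
    smul_eq_mul, ← mul_assoc, ← sq]

lemma sqrt_coeff_zero (hε : ε ^ 2 = 1) (g : FormField n) {ρ : ℝ} (hρ : 0 < ρ) :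
    Real.sqrt (coeff g (stereo n ε) (ρ • coordVec n 0) 0 0) =
      4 * ρ / (ρ ^ 2 + 1) ^ 2 * meridianSpeed g (height ε ρ) := by
  have : coeff g (stereo n ε) (ρ • coordVec n 0) 0 0 =
      g (stereo n ε (ρ • coordVec n 0))
        (fderiv ℝ (stereo n ε) (ρ • coordVec n 0) (coordVec n 0))
        (fderiv ℝ (stereo n ε) (ρ • coordVec n 0) (coordVec n 0)) := rfl
  rw [this, fderiv_stereo_axis hε hρ, stereo_axis hε hρ.le, map_smul, map_smul,
    smul_apply, smul_eq_mul, smul_eq_mul, ← mul_assoc, meridianSpeed,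
    ← sq, mul_pow, hε, one_mul, Real.sqrt_mul (by positivity), Real.sqrt_sq (by positivity)]

end Meridian

/-! ### Reduction of Ricci flow to the warping functions -/

section Reduction

variable {n : ℕ}

lemma stereo_one_mem (y : Model n) : stereo n 1 y ∈ unitSphere n \ {northPole n} := by
  refine ⟨by simpa [unitSphere] using norm_stereo (by norm_num) y, fun h => ?_⟩
  have h1 : (stereo n 1 y).snd = (northPole n).snd := by rw [mem_singleton_iff.1 h]
  have h2 : 1 * ((‖y‖ ^ 2 - 1) / (‖y‖ ^ 2 + 1)) = 1 := h1
  have h3 : ‖y‖ ^ 2 + 1 ≠ 0 := by positivity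
  field_simp at h2
  linarith

lemma stereoN_mem_atlas (n : ℕ) : stereo n 1 ∈ atlas n := by
  rw [← stereoN_eq]
  exact Or.inl rfl

lemma stereoS_mem_atlas (n : ℕ) : stereo n (-1) ∈ atlas n := by
  rw [← stereoS_eq]
  exact Or.inr rfl

lemma preimage_stereo_one (n : ℕ) :
    stereo n 1 ⁻¹' (unitSphere n \ {northPole n}) = univ :=
  eq_univ_of_forall stereo_one_mem

/-- The radius `ψ` of an orbit, as a function of `q = |y|²` in the chart `stereoN`. -/
def radiusFn (g : FormField n) (q : ℝ) : ℝ :=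
  Real.sqrt (q * coeff g (stereo n 1) (Real.sqrt q • coordVec n 0) (Fin.last n) (Fin.last n))

/-- The speed `φ` of the meridian, as a function of `q = |y|²` in the chart `stereoN`. -/
def speedFn (g : FormField n) (q : ℝ) : ℝ :=
  Real.sqrt (coeff g (stereo n 1) (Real.sqrt q • coordVec n 0) 0 0 / (4 * q))

variable {g : FormField n}

lemma coeff_posDef (hg : IsRiemannianMetric (unitSphere n \ {northPole n}) g)
    (y : Model n) : (coeff g (stereo n 1) y).PosDef :=
  (hg _ (stereoN_mem_atlas n)).1 y (stereo_one_mem y)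

lemma coeff_diag_pos (hg : IsRiemannianMetric (unitSphere n \ {northPole n}) g)
    (y : Model n) (i : Fin (n + 1)) : 0 < coeff g (stereo n 1) y i i :=
  (coeff_posDef hg y).diag_pos

lemma coeff_symm (hg : IsRiemannianMetric (unitSphere n \ {northPole n}) g)
    (y : Model n) (i j : Fin (n + 1)) :
    coeff g (stereo n 1) y i j = coeff g (stereo n 1) y j i := by
  have := (coeff_posDef hg y).isHermitian.apply i j
  simpa using this.symm

lemma radiusFn_pos (hg : IsRiemannianMetric (unitSphere n \ {northPole n}) g)
    {q : ℝ} (hq : 0 < q) : 0 < radiusFn g q :=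
  Real.sqrt_pos.2 (mul_pos hq (coeff_diag_pos hg _ _))

lemma speedFn_pos (hg : IsRiemannianMetric (unitSphere n \ {northPole n}) g)
    {q : ℝ} (hq : 0 < q) : 0 < speedFn g q :=
  Real.sqrt_pos.2 (div_pos (coeff_diag_pos hg _ _) (by linarith))

lemma radiusFn_sq (hg : IsRiemannianMetric (unitSphere n \ {northPole n}) g)
    {q : ℝ} (hq : 0 < q) : radiusFn g q ^ 2 =
    q * coeff g (stereo n 1) (Real.sqrt q • coordVec n 0) (Fin.last n) (Fin.last n) :=
  Real.sq_sqrt (mul_pos hq (coeff_diag_pos hg _ _)).le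

lemma speedFn_sq (hg : IsRiemannianMetric (unitSphere n \ {northPole n}) g)
    {q : ℝ} (hq : 0 < q) : speedFn g q ^ 2 =
    coeff g (stereo n 1) (Real.sqrt q • coordVec n 0) 0 0 / (4 * q) :=
  Real.sq_sqrt (div_pos (coeff_diag_pos hg _ _) (by linarith)).le

lemma coeff_warped (hg : IsRiemannianMetric (unitSphere n \ {northPole n}) g)
    (hn : 2 ≤ n)
    (hsym : IsRotationallySymmetric (unitSphere n \ {northPole n}) g) {z : Model n}
    (hz : z ≠ 0) : coeff g (stereo n 1) z = Matrix.of fun i j =>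
      radiusFn g (‖z‖ ^ 2) ^ 2 / ‖z‖ ^ 2 * kron i j
        + (4 * speedFn g (‖z‖ ^ 2) ^ 2 - radiusFn g (‖z‖ ^ 2) ^ 2 / (‖z‖ ^ 2) ^ 2)
          * z i * z j := by
  ext i j
  have hp : 0 < ‖z‖ ^ 2 := by positivity
  rw [Matrix.of_apply, radiusFn_sq hg hp, speedFn_sq hg hp, Real.sqrt_sq (norm_nonneg z),
    coeff_radial hn hsym (by norm_num) hz (stereo_one_mem _) (coeff_symm hg _)]
  field_simp

variable {T : ℝ} {G : ℝ → FormField n}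

lemma contDiffOn_coeff_axis (hG : IsRicciFlow (unitSphere n \ {northPole n}) T G)
    (i j : Fin (n + 1)) :
    ContDiffOn ℝ ∞ (fun p : ℝ × ℝ =>
      coeff (G p.1) (stereo n 1) (Real.sqrt p.2 • coordVec n 0) i j) (Ioo 0 T ×ˢ Ioi 0) := by
  have h1 := (hG.2 _ (stereoN_mem_atlas n) i j).1
  rw [preimage_stereo_one] at h1
  have h2 : ContDiffOn ℝ ∞ (fun p : ℝ × ℝ => (p.1, Real.sqrt p.2 • coordVec n 0))
      (Ioo 0 T ×ˢ Ioi 0) := by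
    have h3 : ContDiffOn ℝ ∞ (fun p : ℝ × ℝ => Real.sqrt p.2) (Ioo 0 T ×ˢ Ioi 0) :=
      contDiffOn_snd.sqrt fun p hp => ne_of_gt hp.2
    exact contDiffOn_fst.prodMk (h3.smul contDiffOn_const)
  exact h1.comp h2 fun p hp => ⟨hp.1, mem_univ _⟩

/-- The warping functions of a rotationally symmetric Ricci flow. -/
theorem isWarpedFlow (hn : 2 ≤ n) (hG : IsRicciFlow (unitSphere n \ {northPole n}) T G)
    (hsym : ∀ t ∈ Ioo 0 T, IsRotationallySymmetric (unitSphere n \ {northPole n}) (G t)) :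
    IsWarpedFlow n T (fun t => radiusFn (G t)) (fun t => speedFn (G t)) := by
  have cψ : ContDiffOn ℝ ∞ (fun p : ℝ × ℝ => radiusFn (G p.1) p.2) (Ioo 0 T ×ˢ Ioi 0) :=
    (contDiffOn_snd.mul (contDiffOn_coeff_axis hG _ _)).sqrt fun p hp =>
      (mul_pos hp.2 (coeff_diag_pos (hG.1 _ hp.1) _ _)).ne'
  have cφ : ContDiffOn ℝ ∞ (fun p : ℝ × ℝ => speedFn (G p.1) p.2) (Ioo 0 T ×ˢ Ioi 0) := by
    refine ((contDiffOn_coeff_axis hG _ _).div (contDiffOn_const.mul contDiffOn_snd)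
      fun p hp => ?_).sqrt fun p hp => ?_
    · exact mul_ne_zero four_ne_zero (ne_of_gt hp.2)
    · exact (div_pos (coeff_diag_pos (hG.1 _ hp.1) _ _) (mul_pos four_pos hp.2)).ne'
  have slice : ∀ t ∈ Ioo 0 T, ∀ f : ℝ → ℝ → ℝ,
      ContDiffOn ℝ ∞ (fun p : ℝ × ℝ => f p.1 p.2) (Ioo 0 T ×ˢ Ioi 0) →
      ContDiffOn ℝ ∞ (f t) (Ioi 0) := fun t ht f hf =>
    hf.comp (f := fun q : ℝ => (t, q)) (contDiffOn_const.prodMk contDiffOn_id)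
      fun q hq => ⟨ht, hq⟩
  have key : ∀ t ∈ Ioo 0 T, ∀ q > 0, ∃ S α β : ℝ,
      S = deriv (arcSlope (fun t => radiusFn (G t)) (fun t => speedFn (G t)) t) q
        / speedFn (G t) q ∧
      α = (-(radiusFn (G t) q * S) + ((n : ℝ) - 1)
        * (1 - arcSlope (fun t => radiusFn (G t)) (fun t => speedFn (G t)) t q ^ 2)) / q ∧
      β = (-(4 * n * q * speedFn (G t) q ^ 2 * S / radiusFn (G t) q) - α) / q ∧
      ∀ i j, ricci (coeff (G t) (stereo n 1)) i j (Real.sqrt q • coordVec n 0) =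
        α * kron i j + β * (Real.sqrt q * kron i 0 * (Real.sqrt q * kron j 0)) := by
    intro t ht q hq
    have hm : (t, q) ∈ Ioo 0 T ×ˢ Ioi (0 : ℝ) := ⟨ht, hq⟩
    have hgt := hG.1 t ht
    refine ⟨_, _, _, rfl, rfl, rfl, fun i j => ?_⟩
    have hs := Real.sqrt_pos.2 hq
    have hq' : q = ‖Real.sqrt q • coordVec n 0‖ ^ 2 := by
      rw [norm_smul, norm_coordVec, mul_one, Real.norm_eq_abs, sq_abs, Real.sq_sqrt hq.le]
    have p2 := (speedFn_pos hgt hq).ne'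
    have dφ : HasDerivAt (speedFn (G t)) (deriv (speedFn (G t)) q) q :=
      (hasDerivAt_snd IsWarpedFlow.isOpen_domain (f := fun t => speedFn (G t)) cφ
        hm).differentiableAt.hasDerivAt
    have dψ' : HasDerivAt (deriv (radiusFn (G t))) (deriv (deriv (radiusFn (G t))) q) q :=
      (hasDerivAt_snd IsWarpedFlow.isOpen_domain (f := fun t => deriv (radiusFn (G t)))
        (contDiffOn_deriv_snd IsWarpedFlow.isOpen_domain (f := fun t => radiusFn (G t)) cψ)
        hm).differentiableAt.hasDerivAt
    have hw : deriv (arcSlope (fun t => radiusFn (G t)) (fun t => speedFn (G t)) t) q =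
        (deriv (deriv (radiusFn (G t))) q * speedFn (G t) q
          - deriv (radiusFn (G t)) q * deriv (speedFn (G t)) q) / speedFn (G t) q ^ 2 :=
      (dψ'.div dφ p2).deriv
    have := ricci_warped (slice t ht (fun t => radiusFn (G t)) cψ)
      (slice t ht (fun t => speedFn (G t)) cφ)
      (fun q hq => radiusFn_pos hgt hq) (fun q hq => speedFn_pos hgt hq)
      (fun z hz => coeff_warped hgt hn (hsym t ht) hz)
      (smul_ne_zero hs.ne' (coordVec_ne_zero 0)) hq' rfl rfl rfl
      (S := deriv (arcSlope (fun t => radiusFn (G t)) (fun t => speedFn (G t)) t) q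
        / speedFn (G t) q) (by rw [hw]; field_simp) rfl i j
    rw [this, arcSlope, div_pow]
    simp [coordVec_apply]
  refine ⟨cψ, cφ, fun t ht q hq => radiusFn_pos (hG.1 t ht) hq,
    fun t ht q hq => speedFn_pos (hG.1 t ht) hq, fun t ht q hq => ?_, fun t ht q hq => ?_⟩
  · obtain ⟨S, α, β, hS, hα, hβ, hR⟩ := key t ht q hq
    have hd := (hG.2 _ (stereoN_mem_atlas n) (Fin.last n) (Fin.last n)).2 t ht
      (Real.sqrt q • coordVec n 0) (stereo_one_mem _)
    have p1 := radiusFn_pos (hG.1 t ht) hq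
    have hl : kron (Fin.last n) 0 = 0 := by
      simp [kron, (zero_ne_last (by omega : 1 ≤ n)).symm]
    rw [hR, hl] at hd
    refine ((hd.const_mul q).sqrt (mul_pos hq (coeff_diag_pos (hG.1 t ht) _ _)).ne').congr_deriv ?_
    change _ / (2 * radiusFn (G t) q) = _
    rw [← hS, hα]
    simp only [kron, if_true]
    field_simp
    ring
  · obtain ⟨S, α, β, hS, hα, hβ, hR⟩ := key t ht q hq
    have hd := (hG.2 _ (stereoN_mem_atlas n) 0 0).2 t ht
      (Real.sqrt q • coordVec n 0) (stereo_one_mem _)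
    have p1 := radiusFn_pos (hG.1 t ht) hq
    have p2 := speedFn_pos (hG.1 t ht) hq
    rw [hR] at hd
    refine ((hd.div_const (4 * q)).sqrt
      (div_pos (coeff_diag_pos (hG.1 t ht) _ _) (by linarith)).ne').congr_deriv ?_
    change _ / (2 * speedFn (G t) q) = _
    have hS' : deriv (arcSlope (fun t => radiusFn (G t)) (fun t => speedFn (G t)) t) q
        = S * speedFn (G t) q := by
      rw [hS]
      field_simp
    have hsq := Real.mul_self_sqrt hq.le
    rw [hS', hβ]
    simp only [kron, if_true, mul_one]
    rw [hsq]
    field_simp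
    ring

end Reduction

/-! ### Convergence to the initial metric -/

section Convergence

variable {n : ℕ}

lemma eventually_forall_of_tendsto {X : Type*} [TopologicalSpace X] {K : Set X}
    (hK : IsCompact K) {l : Filter ℝ} {f : ℝ → X → ℝ} {f₀ : X → ℝ}
    (hf : ∀ x ∈ K, Tendsto (fun p : ℝ × X => f p.1 p.2) (l ×ˢ 𝓝 x) (𝓝 (f₀ x)))
    (h : ∀ x ∈ K, 0 < f₀ x) : ∀ᶠ t in l, ∀ x ∈ K, 0 < f t x := by
  have h1 : {p : ℝ × X | 0 < f p.1 p.2} ∈ l ×ˢ 𝓝ˢ K :=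
    hK.mem_prod_nhdsSet_of_forall fun x hx => (hf x hx).eventually_const_lt (h x hx)
  obtain ⟨s, hs, u, hu, hsub⟩ := mem_prod_iff.1 h1
  filter_upwards [hs] with t ht x hx
  have hxu : x ∈ u := subset_of_mem_nhdsSet hu hx
  exact hsub (Set.mk_mem_prod ht hxu)

lemma tendsto_prod_of_tendstoUniformlyOn {X : Type*} [TopologicalSpace X] {K : Set X} {x : X}
    (hK : K ∈ 𝓝 x) {l : Filter ℝ} {f : ℝ → X → ℝ} {f₀ : X → ℝ}
    (h : TendstoUniformlyOn f f₀ l K) (hf₀ : ContinuousAt f₀ x) :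
    Tendsto (fun p : ℝ × X => f p.1 p.2) (l ×ˢ 𝓝 x) (𝓝 (f₀ x)) := by
  rw [Metric.tendsto_nhds]
  intro ε hε
  have h1 := Metric.tendstoUniformlyOn_iff.1 h (ε / 2) (by linarith)
  have h2 : ∀ᶠ y in 𝓝 x, y ∈ K ∧ dist (f₀ y) (f₀ x) < ε / 2 :=
    (eventually_mem_set.2 hK).and (Metric.tendsto_nhds.1 hf₀ (ε / 2) (by linarith))
  filter_upwards [h1.prod_mk h2] with p hp
  have := hp.1 p.2 hp.2.1
  calc dist (f p.1 p.2) (f₀ x) ≤ dist (f p.1 p.2) (f₀ p.2) + dist (f₀ p.2) (f₀ x) :=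
        dist_triangle _ _ _
    _ < ε := by
      rw [dist_comm (f p.1 p.2)]
      linarith [hp.2.2]

variable {g : FormField n}

/-- The radial derivative of a diagonal coefficient on the axis. -/
def axisDeriv (g : FormField n) (i : Fin (n + 1)) (y : Model n) : ℝ :=
  fderiv ℝ (fun z => coeff g (stereo n 1) z i i) y (coordVec n 0)

lemma contDiff_coeff (hg : IsRiemannianMetric (unitSphere n \ {northPole n}) g)
    (i j : Fin (n + 1)) : ContDiff ℝ ∞ fun y => coeff g (stereo n 1) y i j := by
  have := (hg _ (stereoN_mem_atlas n)).2 i j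
  rwa [preimage_stereo_one, contDiffOn_univ] at this

lemma hasDerivAt_radiusFn (hg : IsRiemannianMetric (unitSphere n \ {northPole n}) g) {q : ℝ}
    (hq : 0 < q) : HasDerivAt (radiusFn g)
      ((coeff g (stereo n 1) (Real.sqrt q • coordVec n 0) (Fin.last n) (Fin.last n)
        + q * (axisDeriv g (Fin.last n) (Real.sqrt q • coordVec n 0) * (1 / (2 * Real.sqrt q))))
        / (2 * radiusFn g q)) q := by
  have h1 : HasDerivAt (fun q => Real.sqrt q • coordVec n 0)
      ((1 / (2 * Real.sqrt q)) • coordVec n 0) q :=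
    (Real.hasDerivAt_sqrt hq.ne').smul_const _
  have h2 : HasDerivAt
      (fun q => coeff g (stereo n 1) (Real.sqrt q • coordVec n 0) (Fin.last n) (Fin.last n))
      (axisDeriv g (Fin.last n) (Real.sqrt q • coordVec n 0) * (1 / (2 * Real.sqrt q))) q := by
    have h3 := ((contDiff_coeff hg (Fin.last n) (Fin.last n)).differentiable (by simp)
      (Real.sqrt q • coordVec n 0)).hasFDerivAt.comp_hasDerivAt q h1
    rw [map_smul, smul_eq_mul, mul_comm] at h3
    exact h3
  have h4 := ((hasDerivAt_id q).mul h2).sqrt (mul_pos hq (coeff_diag_pos hg _ _)).ne'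
  refine h4.congr_deriv ?_
  change (1 * _ + q * _) / (2 * radiusFn g q) = _
  rw [one_mul]

/-- The slope `ψ_s` of a metric in the chart `stereoN`. -/
def slopeFn (g : FormField n) (q : ℝ) : ℝ := deriv (radiusFn g) q / speedFn g q

variable {g₀ : FormField n} {G : ℝ → FormField n} {T : ℝ}

lemma tendsto_coeff (hg₀ : IsRiemannianMetric (unitSphere n \ {northPole n}) g₀)
    (hconv : ConvergesSmoothly G g₀) (i : Fin (n + 1)) (y : Model n) :
    Tendsto (fun p : ℝ × Model n => coeff (G p.1) (stereo n 1) p.2 i i) (𝓝[>] 0 ×ˢ 𝓝 y)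
      (𝓝 (coeff g₀ (stereo n 1) y i i)) := by
  have h := hconv i i 0 (Metric.closedBall y 1) (isCompact_closedBall y 1)
  have h1 := (ContinuousMultilinearMap.apply ℝ (fun _ : Fin 0 => Model n) ℝ
    (fun _ => 0)).uniformContinuous.comp_tendstoUniformlyOn h
  simp only [Function.comp_def, ContinuousMultilinearMap.apply_apply,
    iteratedFDeriv_zero_apply, stereoN_eq] at h1
  exact tendsto_prod_of_tendstoUniformlyOn (Metric.closedBall_mem_nhds y one_pos) h1
    (contDiff_coeff hg₀ i i).continuous.continuousAt

lemma tendsto_axisDeriv (hg₀ : IsRiemannianMetric (unitSphere n \ {northPole n}) g₀)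
    (hconv : ConvergesSmoothly G g₀) (i : Fin (n + 1)) (y : Model n) :
    Tendsto (fun p : ℝ × Model n => axisDeriv (G p.1) i p.2) (𝓝[>] 0 ×ˢ 𝓝 y)
      (𝓝 (axisDeriv g₀ i y)) := by
  have h := hconv i i 1 (Metric.closedBall y 1) (isCompact_closedBall y 1)
  have h1 := (ContinuousMultilinearMap.apply ℝ (fun _ : Fin 1 => Model n) ℝ
    (fun _ => coordVec n 0)).uniformContinuous.comp_tendstoUniformlyOn h
  simp only [Function.comp_def, ContinuousMultilinearMap.apply_apply,
    iteratedFDeriv_one_apply, stereoN_eq] at h1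
  refine tendsto_prod_of_tendstoUniformlyOn (Metric.closedBall_mem_nhds y one_pos) h1 ?_
  exact (((contDiff_coeff hg₀ i i).continuous_fderiv (by simp)).clm_apply
    continuous_const).continuousAt

lemma tendsto_axis {q : ℝ} : Tendsto (fun p : ℝ × ℝ => (p.1, Real.sqrt p.2 • coordVec n 0))
    (𝓝[>] 0 ×ˢ 𝓝 q) (𝓝[>] 0 ×ˢ 𝓝 (Real.sqrt q • coordVec n 0)) := by
  have h : Tendsto (fun q : ℝ => Real.sqrt q • coordVec n 0) (𝓝 q)
      (𝓝 (Real.sqrt q • coordVec n 0)) :=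
    (Real.continuous_sqrt.smul continuous_const).tendsto q
  exact tendsto_id.prodMap h

lemma tendsto_radiusFn (hg₀ : IsRiemannianMetric (unitSphere n \ {northPole n}) g₀)
    (hconv : ConvergesSmoothly G g₀) (q : ℝ) :
    Tendsto (fun p : ℝ × ℝ => radiusFn (G p.1) p.2) (𝓝[>] 0 ×ˢ 𝓝 q) (𝓝 (radiusFn g₀ q)) := by
  have h := (tendsto_coeff hg₀ hconv (Fin.last n) (Real.sqrt q • coordVec n 0)).comp
    (tendsto_axis (q := q))
  exact (tendsto_snd.mul h).sqrt

lemma tendsto_speedFn (hg₀ : IsRiemannianMetric (unitSphere n \ {northPole n}) g₀)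
    (hconv : ConvergesSmoothly G g₀) {q : ℝ} (hq : 0 < q) :
    Tendsto (fun p : ℝ × ℝ => speedFn (G p.1) p.2) (𝓝[>] 0 ×ˢ 𝓝 q) (𝓝 (speedFn g₀ q)) := by
  have h := (tendsto_coeff hg₀ hconv 0 (Real.sqrt q • coordVec n 0)).comp
    (tendsto_axis (q := q))
  exact (h.div (tendsto_const_nhds.mul tendsto_snd) (by positivity)).sqrt

lemma tendsto_slopeFn (hT : 0 < T) (hg₀ : IsRiemannianMetric (unitSphere n \ {northPole n}) g₀)
    (hG : ∀ t ∈ Ioo 0 T, IsRiemannianMetric (unitSphere n \ {northPole n}) (G t))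
    (hconv : ConvergesSmoothly G g₀) {q : ℝ} (hq : 0 < q) :
    Tendsto (fun p : ℝ × ℝ => slopeFn (G p.1) p.2) (𝓝[>] 0 ×ˢ 𝓝 q) (𝓝 (slopeFn g₀ q)) := by
  refine Tendsto.div ?_ (tendsto_speedFn hg₀ hconv hq) (speedFn_pos hg₀ hq).ne'
  rw [(hasDerivAt_radiusFn hg₀ hq).deriv]
  have hs : Real.sqrt q ≠ 0 := (Real.sqrt_pos.2 hq).ne'
  have h : Tendsto (fun p : ℝ × ℝ =>
      (coeff (G p.1) (stereo n 1) (Real.sqrt p.2 • coordVec n 0) (Fin.last n) (Fin.last n)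
        + p.2 * (axisDeriv (G p.1) (Fin.last n) (Real.sqrt p.2 • coordVec n 0)
          * (1 / (2 * Real.sqrt p.2)))) / (2 * radiusFn (G p.1) p.2)) (𝓝[>] 0 ×ˢ 𝓝 q) _ :=
    (((tendsto_coeff hg₀ hconv (Fin.last n) _).comp tendsto_axis).add
      (tendsto_snd.mul (((tendsto_axisDeriv hg₀ hconv (Fin.last n) _).comp tendsto_axis).mul
        (tendsto_const_nhds.div (tendsto_const_nhds.mul
          ((Real.continuous_sqrt.tendsto q).comp tendsto_snd)) (by positivity))))).div
      (tendsto_const_nhds.mul (tendsto_radiusFn hg₀ hconv q))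
      (mul_ne_zero two_ne_zero (radiusFn_pos hg₀ hq).ne')
  refine h.congr' ?_
  filter_upwards [(eventually_mem_set.2 (Ioo_mem_nhdsGT hT)).prod_mk
    (eventually_mem_set.2 (Ioi_mem_nhds hq))] with p hp
  exact ((hasDerivAt_radiusFn (hG p.1 hp.1) hp.2).deriv).symm

end Convergence

/-! ### The initial metric near its singularity -/

section Initial

variable {n : ℕ}

lemma IsNeckpinchWarping.eventually_lt_deriv_sq (hn : 2 ≤ n) {ℓ : ℝ} {ψ₀ : ℝ → ℝ}
    (h : IsNeckpinchWarping n ℓ ψ₀) :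
    ∀ᶠ s in 𝓝[>] (0 : ℝ), 0 < deriv ψ₀ s ∧ ψ₀ s < deriv ψ₀ s ^ 2 := by
  set c : ℝ := ((n : ℝ) - 1) / 4 with hc
  have hc0 : 0 < c := by
    have : (2 : ℝ) ≤ n := by exact_mod_cast hn
    rw [hc]
    linarith
  have h1 := h.asymp_deriv.eventually_const_lt (half_lt_self hc0)
  have h2 : ∀ᶠ s in 𝓝[>] (0 : ℝ), (Real.log s * s ^ (1 / 2 : ℝ)) ^ 2 < (c / 2) ^ 2 := by
    have := (tendsto_log_mul_rpow_nhdsGT_zero (r := 1 / 2) (by norm_num)).pow 2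
    refine this.eventually_lt_const ?_
    rw [zero_pow two_ne_zero]
    exact pow_pos (half_pos hc0) 2
  filter_upwards [h1, h2, Ioo_mem_nhdsGT h.length_pos, Ioo_mem_nhdsGT one_pos]
    with s hs1 hs2 hs hs'
  have hψ := h.pos s hs
  have hL : 0 < -Real.log s := by linarith [Real.log_neg hs'.1 hs'.2]
  have hψs : ψ₀ s ≤ s := by
    obtain ⟨x, hx, hx'⟩ := exists_deriv_eq_slope ψ₀ hs.1
      (h.c1.continuousOn.mono (Icc_subset_Icc_right hs.2.le))
      ((h.smooth.differentiableOn (by simp)).mono (Ioo_subset_Ioo_right hs.2.le))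
    have := (abs_le.1 (h.deriv_le x ⟨hx.1, hx.2.trans hs.2⟩)).2
    rw [hx', h.zero_left, sub_zero, sub_zero, div_le_one hs.1] at this
    exact this
  have k1 : c / 2 * (s / -Real.log s) < ψ₀ s * deriv ψ₀ s := by
    rwa [lt_div_iff₀ (div_pos hs.1 hL)] at hs1
  have hd : 0 < deriv ψ₀ s := by
    refine pos_of_mul_pos_right (lt_trans ?_ k1) hψ.le
    have := div_pos hs.1 hL
    positivity
  refine ⟨hd, ?_⟩
  have k2 : c / 2 * (s / -Real.log s) < s * deriv ψ₀ s :=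
    k1.trans_le (mul_le_mul_of_nonneg_right hψs hd.le)
  have k3 : c / 2 < deriv ψ₀ s * -Real.log s := by
    have : c / 2 * (s / -Real.log s) = s * (c / 2 / -Real.log s) := by ring
    rw [this, mul_lt_mul_iff_right₀ hs.1, div_lt_iff₀ hL] at k2
    exact k2
  have k4 : (c / 2) ^ 2 < (deriv ψ₀ s * -Real.log s) ^ 2 := by
    have := hc0
    gcongr
  have k5 : (Real.log s * s ^ (1 / 2 : ℝ)) ^ 2 = (-Real.log s) ^ 2 * s := by
    rw [mul_pow, ← Real.sqrt_eq_rpow, Real.sq_sqrt hs.1.le, neg_sq]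
  rw [k5] at hs2
  have k6 : (-Real.log s) ^ 2 * s < (-Real.log s) ^ 2 * deriv ψ₀ s ^ 2 := by
    have := hs2.trans k4
    rw [mul_pow, mul_comm (deriv ψ₀ s ^ 2)] at this
    exact this
  exact hψs.trans_lt (lt_of_mul_lt_mul_left k6 (by positivity))

lemma radiusFn_eq_orbitRadius (hn : 1 ≤ n) (g : FormField n) {q : ℝ} (hq : 0 ≤ q) :
    radiusFn g q = orbitRadius g (height 1 (Real.sqrt q)) := by
  rw [orbitRadius_eq hn (by norm_num) g (Real.sqrt_nonneg q), Real.sq_sqrt hq, radiusFn]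

lemma speedFn_eq_meridianSpeed (g : FormField n) {q : ℝ} (hq : 0 < q) :
    speedFn g q = 2 / (q + 1) ^ 2 * meridianSpeed g (height 1 (Real.sqrt q)) := by
  have hs := Real.sqrt_pos.2 hq
  rw [speedFn, Real.sqrt_div' _ (by positivity), sqrt_coeff_zero (by norm_num) g hs,
    Real.sqrt_mul (by norm_num), Real.sq_sqrt hq.le,
    show (4 : ℝ) = 2 ^ 2 by norm_num, Real.sqrt_sq (by norm_num)]
  field_simp

lemma height_one_sqrt {q : ℝ} (hq : 0 ≤ q) : height 1 (Real.sqrt q) = (q - 1) / (q + 1) := by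
  rw [height, Real.sq_sqrt hq, one_mul]

lemma tendsto_height_sqrt : Tendsto (fun q => height 1 (Real.sqrt q)) atTop (𝓝[<] 1) := by
  refine tendsto_nhdsWithin_iff.2 ⟨?_, ?_⟩
  · have h : Tendsto (fun q : ℝ => 1 - 2 / (q + 1)) atTop (𝓝 (1 - 0)) :=
      tendsto_const_nhds.sub ((tendsto_atTop_add_const_right _ _ tendsto_id).const_div_atTop 2)
    rw [sub_zero] at h
    refine h.congr' ?_
    filter_upwards [eventually_ge_atTop (0 : ℝ)] with q hq
    rw [height_one_sqrt hq]
    field_simp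
    ring
  · filter_upwards [eventually_gt_atTop (0 : ℝ)] with q hq
    exact (height_mem (by norm_num) (Real.sqrt_pos.2 hq)).2

/-- Near the singularity the initial metric satisfies the lower barrier. -/
lemma IsNeckpinchMetric.eventually_slopeFn (hn : 2 ≤ n) {g₀ : FormField n}
    (h : IsNeckpinchMetric g₀) :
    ∀ᶠ q in atTop, slopeFn g₀ q < 0 ∧ radiusFn g₀ q < slopeFn g₀ q ^ 2 := by
  obtain ⟨ℓ, ψ₀, s, hw, hs, hs1, -, hψ⟩ := h.warping
  have hspeed : ∀ q > 0, 0 < meridianSpeed g₀ (height 1 (Real.sqrt q)) := by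
    intro q hq
    have h1 := speedFn_pos h.metric hq
    rw [speedFn_eq_meridianSpeed g₀ hq] at h1
    exact pos_of_mul_pos_right h1 (by positivity)
  set σ : ℝ → ℝ := fun q => s (height 1 (Real.sqrt q)) with hσ
  have dσ : ∀ q > 0, HasDerivAt σ (-speedFn g₀ q) q := by
    intro q hq
    have h1 : HasDerivAt (fun q => height 1 (Real.sqrt q)) (2 / (q + 1) ^ 2) q := by
      have h2 : HasDerivAt (fun q : ℝ => (q - 1) / (q + 1)) (2 / (q + 1) ^ 2) q := by
        refine (((hasDerivAt_id q).sub_const 1).div ((hasDerivAt_id q).add_const 1)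
          (by simp only [id]; linarith)).congr_deriv ?_
        simp only [id]
        ring
      refine h2.congr_of_eventuallyEq ?_
      filter_upwards [Ioi_mem_nhds hq] with x hx using height_one_sqrt (le_of_lt hx)
    refine ((hs _ (height_mem (by norm_num) (Real.sqrt_pos.2 hq))).comp q h1).congr_deriv ?_
    rw [speedFn_eq_meridianSpeed g₀ hq]
    ring
  have hσ0 : Tendsto σ atTop (𝓝 0) := hs1.comp tendsto_height_sqrt
  have hanti : StrictAntiOn σ (Ioi 0) := by
    refine strictAntiOn_of_deriv_neg (convex_Ioi 0)
      (fun q hq => (dσ q hq).continuousAt.continuousWithinAt) fun q hq => ?_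
    rw [interior_Ioi] at hq
    rw [(dσ q hq).deriv]
    linarith [speedFn_pos h.metric hq]
  have hσpos : ∀ q > 0, 0 < σ q := by
    intro q hq
    have h1 : σ (q + 1) < σ q := hanti hq (by simp; linarith) (by linarith)
    refine lt_of_le_of_lt ?_ h1
    refine le_of_tendsto hσ0 ?_
    filter_upwards [eventually_ge_atTop (q + 1)] with x hx
    exact hanti.antitoneOn (by simp; linarith) (by simp; linarith) hx
  have hσ' : Tendsto σ atTop (𝓝[>] 0) := by
    refine tendsto_nhdsWithin_iff.2 ⟨hσ0, ?_⟩
    filter_upwards [eventually_gt_atTop (0 : ℝ)] with q hq using hσpos q hq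
  filter_upwards [hσ'.eventually (hw.eventually_lt_deriv_sq hn), eventually_gt_atTop (0 : ℝ),
    hσ'.eventually (Ioo_mem_nhdsGT hw.length_pos)] with q hq hq0 hq1
  have hr : ∀ x > 0, radiusFn g₀ x = ψ₀ (σ x) := by
    intro x hx
    rw [radiusFn_eq_orbitRadius (by omega) g₀ hx.le]
    exact hψ _ (height_mem (by norm_num) (Real.sqrt_pos.2 hx))
  have hd : HasDerivAt (radiusFn g₀) (deriv ψ₀ (σ q) * (-speedFn g₀ q)) q := by
    have h1 : HasDerivAt ψ₀ (deriv ψ₀ (σ q)) (σ q) :=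
      ((hw.smooth.differentiableOn (by simp)).differentiableAt
        (isOpen_Ioo.mem_nhds hq1)).hasDerivAt
    refine (h1.comp q (dσ q hq0)).congr_of_eventuallyEq ?_
    filter_upwards [Ioi_mem_nhds hq0] with x hx using hr x hx
  have hslope : slopeFn g₀ q = -deriv ψ₀ (σ q) := by
    have := (speedFn_pos h.metric hq0).ne'
    rw [slopeFn, hd.deriv]
    field_simp
  rw [hslope, hr q hq0, neg_sq]
  exact ⟨by linarith [hq.1], hq.2⟩

end Initial

/-! ### Forward evolutions cannot be complete on the punctured sphere -/

section Incomplete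

variable {n : ℕ} {g₀ : FormField n} {G : ℝ → FormField n} {T : ℝ}

lemma radiusFn_nonneg (g : FormField n) (q : ℝ) : 0 ≤ radiusFn g q := Real.sqrt_nonneg _

lemma speedFn_nonneg (g : FormField n) (q : ℝ) : 0 ≤ speedFn g q := Real.sqrt_nonneg _

lemma deriv_radiusFn_eq {g : FormField n}
    (hg : IsRiemannianMetric (unitSphere n \ {northPole n}) g) {q : ℝ} (hq : 0 < q) :
    deriv (radiusFn g) q = speedFn g q * slopeFn g q := by
  have := (speedFn_pos hg hq).ne'
  rw [slopeFn]
  field_simp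

lemma strictAntiOn_radiusFn {g : FormField n}
    (hg : IsRiemannianMetric (unitSphere n \ {northPole n}) g) {s : Set ℝ} (hs : Convex ℝ s)
    (hpos : s ⊆ Ioi 0) (h : ∀ q ∈ s, slopeFn g q < 0) : StrictAntiOn (radiusFn g) s := by
  refine strictAntiOn_of_deriv_neg hs
    (fun q hq => (hasDerivAt_radiusFn hg (hpos hq)).continuousAt.continuousWithinAt) fun q hq => ?_
  have hq' := interior_subset hq
  rw [deriv_radiusFn_eq hg (hpos hq')]
  exact mul_neg_of_pos_of_neg (speedFn_pos hg (hpos hq')) (h q hq')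

/-- A forward evolution on the punctured sphere satisfies the barrier at some positive time. -/
theorem exists_barrier (hn : 2 ≤ n) (hg₀ : IsNeckpinchMetric g₀)
    (hG : IsForwardEvolution g₀ (unitSphere n \ {northPole n}) T G) :
    ∃ t ∈ Ioo 0 T, ∃ q₀ > 0, Tendsto (radiusFn (G t)) atTop (𝓝 0) ∧
      ∀ q > q₀, slopeFn (G t) q ≤ 0 ∧ 1 / 2 * radiusFn (G t) q ≤ slopeFn (G t) q ^ 2 := by
  obtain ⟨t₁, ht₁, hunif⟩ := hG.radius_tendsto rfl
  have hflow := isWarpedFlow hn hG.flow hG.symmetric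
  have hsmall' : ∀ ε > 0, ∀ᶠ q in atTop, ∀ t ∈ Ioo 0 t₁, radiusFn (G t) q < ε := by
    intro ε hε
    filter_upwards [tendsto_height_sqrt.eventually (Metric.tendstoUniformlyOn_iff.1 hunif ε hε),
      eventually_ge_atTop (0 : ℝ)] with q hq hq0 t ht
    have := hq t ht
    rw [dist_comm, Real.dist_eq, sub_zero, ← radiusFn_eq_orbitRadius (by omega) _ hq0] at this
    exact (abs_lt.1 this).2
  have hmet : ∀ t ∈ Ioo 0 t₁, IsRiemannianMetric (unitSphere n \ {northPole n}) (G t) :=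
    fun t ht => hG.flow.1 t ⟨ht.1, ht.2.trans ht₁.2⟩
  obtain ⟨q₀, hq₀, hprofile, hlt⟩ : ∃ q₀ > 0,
      (∀ q ≥ q₀, slopeFn g₀ q < 0 ∧ radiusFn g₀ q < slopeFn g₀ q ^ 2) ∧
      ∀ t ∈ Ioo 0 t₁, ∀ q ≥ q₀, radiusFn (G t) q < 1 := by
    obtain ⟨q₀, h⟩ := eventually_atTop.1
      (((hg₀.eventually_slopeFn hn).and (hsmall' 1 one_pos)).and (eventually_gt_atTop (0 : ℝ)))
    exact ⟨q₀, (h q₀ le_rfl).2, fun q hq => (h q hq).1.1, fun t ht q hq => (h q hq).1.2 t ht⟩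
  have hanti : StrictAntiOn (radiusFn g₀) (Ici q₀) :=
    strictAntiOn_radiusFn hg₀.metric (convex_Ici q₀) (fun q hq => hq₀.trans_le hq)
      fun q hq => (hprofile q hq).1
  have jr := tendsto_radiusFn (G := G) hg₀.metric hG.initial
  have js := fun (q : ℝ) (hq : 0 < q) => tendsto_slopeFn ht₁.1 hg₀.metric hmet hG.initial hq
  have ev1 : ∀ᶠ t in 𝓝[>] (0 : ℝ), ∀ q ∈ ({q₀} : Set ℝ),
      0 < slopeFn (G t) q ^ 2 - 1 / 2 * radiusFn (G t) q := by
    refine eventually_forall_of_tendsto isCompact_singleton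
      (f := fun t q => slopeFn (G t) q ^ 2 - 1 / 2 * radiusFn (G t) q)
      (f₀ := fun q => slopeFn g₀ q ^ 2 - 1 / 2 * radiusFn g₀ q) (fun q hq => ?_) fun q hq => ?_
    · rw [mem_singleton_iff.1 hq]
      exact ((js q₀ hq₀).pow 2).sub (tendsto_const_nhds.mul (jr q₀))
    · rw [mem_singleton_iff.1 hq]
      linarith [(hprofile q₀ le_rfl).2, radiusFn_pos hg₀.metric hq₀]
  have ev2 : ∀ᶠ t in 𝓝[>] (0 : ℝ), ∀ q ∈ Icc q₀ (q₀ + 1), 0 < -slopeFn (G t) q :=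
    eventually_forall_of_tendsto isCompact_Icc (f₀ := fun q => -slopeFn g₀ q)
      (fun q hq => (js q (hq₀.trans_le hq.1)).neg)
      fun q hq => by linarith [(hprofile q hq.1).1]
  have r0 := radiusFn_pos hg₀.metric hq₀
  obtain ⟨q₁, hq₁⟩ := eventually_atTop.1 (hsmall' (radiusFn g₀ q₀ / 2) (half_pos r0))
  have ev3 : ∀ᶠ t in 𝓝[>] (0 : ℝ), ∀ p ∈ ({q₀} : Set ℝ) ×ˢ Icc (q₀ + 1) q₁,
      0 < radiusFn (G t) p.1 - radiusFn (G t) p.2 := by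
    refine eventually_forall_of_tendsto (isCompact_singleton.prod isCompact_Icc)
      (f := fun t p => radiusFn (G t) p.1 - radiusFn (G t) p.2)
      (f₀ := fun p : ℝ × ℝ => radiusFn g₀ p.1 - radiusFn g₀ p.2) (fun p hp => ?_) fun p hp => ?_
    · exact ((jr p.1).comp (tendsto_id.prodMap continuous_fst.continuousAt)).sub
        ((jr p.2).comp (tendsto_id.prodMap continuous_snd.continuousAt))
    · have h1 : p.1 = q₀ := hp.1
      have h2 := hp.2.1
      have := hanti (a := p.1) (b := p.2) (by simp [h1]) (by simp; linarith) (by linarith)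
      linarith
  have ev4 : ∀ᶠ t in 𝓝[>] (0 : ℝ), ∀ q ∈ ({q₀} : Set ℝ),
      0 < radiusFn (G t) q - radiusFn g₀ q₀ / 2 := by
    refine eventually_forall_of_tendsto isCompact_singleton
      (f := fun t q => radiusFn (G t) q - radiusFn g₀ q₀ / 2)
      (f₀ := fun q => radiusFn g₀ q - radiusFn g₀ q₀ / 2) (fun q hq => ?_) fun q hq => ?_
    · exact (jr q).sub tendsto_const_nhds
    · rw [mem_singleton_iff.1 hq]
      linarith
  obtain ⟨t₂, ht₂, hsub⟩ := mem_nhdsGT_iff_exists_Ioo_subset.1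
    (ev1.and (ev2.and (ev3.and (ev4.and (eventually_mem_set.2 (Ioo_mem_nhdsGT ht₁.1))))))
  have hev : ∀ t ∈ Ioo 0 t₂, 1 / 2 * radiusFn (G t) q₀ ≤ slopeFn (G t) q₀ ^ 2 ∧
      (∀ q ∈ Icc q₀ (q₀ + 1), slopeFn (G t) q < 0) ∧
      (∀ q ∈ Icc (q₀ + 1) q₁, radiusFn (G t) q < radiusFn (G t) q₀) ∧
      radiusFn g₀ q₀ / 2 < radiusFn (G t) q₀ ∧ t ∈ Ioo 0 t₁ := by
    intro t ht
    obtain ⟨h1, h2, h3, h4, h5⟩ := hsub ht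
    exact ⟨by linarith [h1 q₀ rfl], fun q hq => by linarith [h2 q hq],
      fun q hq => by linarith [h3 (q₀, q) ⟨rfl, hq⟩], by linarith [h4 q₀ rfl], h5⟩
  have hsmall : ∀ ε > 0, ∃ q₁, ∀ q ≥ q₁, ∀ t ∈ Ioo 0 t₂, radiusFn (G t) q < ε := by
    intro ε hε
    obtain ⟨q, hq⟩ := eventually_atTop.1 (hsmall' ε hε)
    exact ⟨q, fun x hx t ht => hq x hx t (hev t ht).2.2.2.2⟩
  have ht₂T : t₂ ≤ T := by
    by_contra hcon
    have hTt : T ∈ Ioo 0 t₂ := ⟨hG.time_pos, not_le.1 hcon⟩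
    linarith [(hev T hTt).2.2.2.2.2, ht₁.2]
  have hbdry : ∀ t ∈ Ioo 0 t₂, ∀ y ≥ q₀, radiusFn (G t) y ≤ radiusFn (G t) q₀ := by
    intro t ht y hy
    obtain ⟨-, h2, h3, h4, h5⟩ := hev t ht
    rcases le_total y (q₀ + 1) with h | h
    · exact (strictAntiOn_radiusFn (hmet t h5) (convex_Icc q₀ (q₀ + 1))
        (fun q hq => hq₀.trans_le hq.1) h2).antitoneOn ⟨le_rfl, by linarith⟩ ⟨hy, h⟩ hy
    · rcases le_total y q₁ with h' | h'
      · exact (h3 y ⟨h, h'⟩).le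
      · linarith [hq₁ y h' t h5]
  have hstart1 : ∀ ε > 0, ∀ q₁, ∀ᶠ t in 𝓝[>] (0 : ℝ), ∀ x ∈ Icc q₀ q₁, ∀ y ∈ Icc x q₁,
      radiusFn (G t) y ^ 2 < radiusFn (G t) x ^ 2 + ε := by
    intro ε hε q₁
    have hK : IsCompact ((Icc q₀ q₁ ×ˢ Icc q₀ q₁) ∩ {p : ℝ × ℝ | p.1 ≤ p.2}) :=
      (isCompact_Icc.prod isCompact_Icc).inter_right (isClosed_le continuous_fst continuous_snd)
    have := eventually_forall_of_tendsto hK (l := 𝓝[>] (0 : ℝ))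
      (f := fun t p => radiusFn (G t) p.1 ^ 2 + ε - radiusFn (G t) p.2 ^ 2)
      (f₀ := fun p : ℝ × ℝ => radiusFn g₀ p.1 ^ 2 + ε - radiusFn g₀ p.2 ^ 2)
      (fun p hp => ((((jr p.1).comp
        (tendsto_id.prodMap continuous_fst.continuousAt)).pow 2).add tendsto_const_nhds).sub
        (((jr p.2).comp (tendsto_id.prodMap continuous_snd.continuousAt)).pow 2))
      (fun p hp => by
        have h1 := hanti.antitoneOn (a := p.1) (b := p.2) hp.1.1.1 hp.1.2.1 hp.2
        have h2 := radiusFn_pos hg₀.metric (hq₀.trans_le hp.1.2.1)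
        nlinarith)
    filter_upwards [this] with t ht x hx y hy
    linarith [ht (x, y) ⟨⟨hx, ⟨hx.1.trans hy.1, hy.2⟩⟩, hy.1⟩]
  have hmono : ∀ t ∈ Ioo 0 t₂, AntitoneOn (radiusFn (G t)) (Ici q₀) := fun t ht x hx y _ hxy =>
    hflow.radius_antitone hq₀ ht₂T hsmall hbdry hstart1 ht hx hxy
  have hslope : ∀ t ∈ Ioo 0 t₂, ∀ q > q₀, slopeFn (G t) q ≤ 0 := by
    intro t ht q hq
    have h1 : deriv (radiusFn (G t)) q ≤ 0 := by
      rw [← derivWithin_of_mem_nhds (Ici_mem_nhds hq)]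
      exact (hmono t ht).derivWithin_nonpos
    exact div_nonpos_of_nonpos_of_nonneg h1
      (speedFn_pos (hmet t (hev t ht).2.2.2.2) (hq₀.trans hq)).le
  have hstart2 : ∀ δ > 0, ∀ q₁, ∀ᶠ t in 𝓝[>] (0 : ℝ), ∀ q ∈ Icc q₀ q₁,
      1 / 2 * (radiusFn (G t) q - δ) < slopeFn (G t) q ^ 2 := by
    intro δ hδ q₁
    have := eventually_forall_of_tendsto (isCompact_Icc (a := q₀) (b := q₁))
      (l := 𝓝[>] (0 : ℝ))
      (f := fun t q => slopeFn (G t) q ^ 2 - 1 / 2 * (radiusFn (G t) q - δ))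
      (f₀ := fun q => slopeFn g₀ q ^ 2 - 1 / 2 * (radiusFn g₀ q - δ))
      (fun q hq => ((js q (hq₀.trans_le hq.1)).pow 2).sub
        (tendsto_const_nhds.mul ((jr q).sub tendsto_const_nhds)))
      (fun q hq => by
        have h2 := radiusFn_pos hg₀.metric (hq₀.trans_le hq.1)
        linarith [(hprofile q hq.1).2])
    filter_upwards [this] with t ht q hq
    linarith [ht q hq]
  have hmem : t₂ / 2 ∈ Ioo 0 t₂ := ⟨half_pos ht₂, half_lt_self ht₂⟩
  refine ⟨t₂ / 2, ⟨hmem.1, hmem.2.trans_le ht₂T⟩, q₀, hq₀, ?_, fun q hq => ⟨hslope _ hmem q hq, ?_⟩⟩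
  · rw [Metric.tendsto_nhds]
    intro ε hε
    filter_upwards [hsmall' ε hε] with q hq
    have h5 := (hev _ hmem).2.2.2.2
    rw [Real.dist_eq, sub_zero, abs_of_nonneg (radiusFn_nonneg _ q)]
    exact hq _ h5
  · exact hflow.le_arcSlope_sq hn hq₀ ht₂T (by norm_num) le_rfl hsmall hslope
      (fun t ht q hq => hlt t (hev t ht).2.2.2.2 q hq) (fun t ht => (hev t ht).1) hstart2 hmem
      (le_of_lt hq)

/-- The distance between two orbits along the meridian. -/
lemma riemDist_le {g : FormField n} (hg : IsRiemannianMetric (unitSphere n \ {northPole n}) g)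
    {a b : ℝ} (ha : 0 < a) (hb : 0 < b) :
    riemDist (unitSphere n \ {northPole n}) g (stereo n 1 (Real.sqrt a • coordVec n 0))
      (stereo n 1 (Real.sqrt b • coordVec n 0)) ≤ ENNReal.ofReal |∫ q in a..b, speedFn g q| := by
  have hpos : ∀ τ ∈ Icc (0 : ℝ) 1, 0 < a + (b - a) * τ := by
    intro τ hτ
    rcases hτ.2.lt_or_eq with h | h
    · nlinarith [mul_nonneg hb.le hτ.1]
    · rw [h]
      linarith
  set γ : ℝ → Ambient n := fun τ => stereo n 1 (Real.sqrt (a + (b - a) * τ) • coordVec n 0)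
    with hγ
  have hsmooth : ContDiffOn ℝ 1 γ (Icc 0 1) := by
    have h1 : ContDiffOn ℝ 1 (fun τ : ℝ => Real.sqrt (a + (b - a) * τ)) (Icc 0 1) :=
      ContDiffOn.sqrt (by fun_prop) fun τ hτ => (hpos τ hτ).ne'
    exact ((contDiff_stereo n 1).of_le (by simp)).comp_contDiffOn (h1.smul contDiffOn_const)
  have hmem : γ ∈ curvesIn (unitSphere n \ {northPole n})
      (stereo n 1 (Real.sqrt a • coordVec n 0)) (stereo n 1 (Real.sqrt b • coordVec n 0)) :=
    ⟨hsmooth, fun τ _ => stereo_one_mem _, by simp [hγ], by simp [hγ]⟩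
  refine (iInf₂_le γ hmem).trans ?_
  have hder : ∀ τ ∈ Icc (0 : ℝ) 1, Real.sqrt
      (g (γ τ) (derivWithin γ (Icc 0 1) τ) (derivWithin γ (Icc 0 1) τ)) =
      |b - a| * speedFn g (a + (b - a) * τ) := by
    intro τ hτ
    set q := a + (b - a) * τ with hq
    have hq0 : 0 < q := hpos τ hτ
    have h1 : HasDerivAt (fun τ => a + (b - a) * τ) (b - a) τ := by
      simpa using ((hasDerivAt_id τ).const_mul (b - a)).const_add a
    have h2 : HasDerivAt (fun τ => Real.sqrt (a + (b - a) * τ))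
        ((b - a) / (2 * Real.sqrt q)) τ := h1.sqrt hq0.ne'
    have h3 : HasDerivAt γ (fderiv ℝ (stereo n 1) (Real.sqrt q • coordVec n 0)
        (((b - a) / (2 * Real.sqrt q)) • coordVec n 0)) τ := by
      have h := h2.smul_const (coordVec n 0)
      have h' : HasFDerivAt (stereo n 1) (fderiv ℝ (stereo n 1) (Real.sqrt q • coordVec n 0))
        ((fun τ => Real.sqrt (a + (b - a) * τ) • coordVec n 0) τ) := hasFDerivAt_stereo n 1 _
      exact h'.comp_hasDerivAt τ h
    rw [h3.hasDerivWithinAt.derivWithin (uniqueDiffOn_Icc_zero_one τ hτ)]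
    have h4 : g (γ τ)
        (fderiv ℝ (stereo n 1) (Real.sqrt q • coordVec n 0)
          (((b - a) / (2 * Real.sqrt q)) • coordVec n 0))
        (fderiv ℝ (stereo n 1) (Real.sqrt q • coordVec n 0)
          (((b - a) / (2 * Real.sqrt q)) • coordVec n 0)) =
        ((b - a) / (2 * Real.sqrt q)) ^ 2 *
          coeff g (stereo n 1) (Real.sqrt q • coordVec n 0) 0 0 := by
      change chartForm g (stereo n 1) (Real.sqrt q • coordVec n 0) _ _ = _
      rw [map_smul, map_smul, smul_apply, smul_eq_mul, smul_eq_mul, ← mul_assoc, ← sq,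
        coeff_eq_chartForm]
    rw [h4, speedFn, ← Real.sqrt_sq_eq_abs, ← Real.sqrt_mul (sq_nonneg _), div_pow, mul_pow,
      Real.sq_sqrt hq0.le]
    congr 1
    ring
  have hc : ContinuousOn (fun τ => |b - a| * speedFn g (a + (b - a) * τ)) (Icc 0 1) := by
    have h1 : ContinuousOn (speedFn g) (Ioi 0) := by
      refine ContinuousOn.sqrt (ContinuousOn.div ?_ (by fun_prop) fun q hq => ?_)
      · exact (contDiff_coeff hg 0 0).continuous.comp_continuousOn
          (Real.continuous_sqrt.smul continuous_const).continuousOn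
      · exact mul_ne_zero four_ne_zero (ne_of_gt hq)
    exact continuousOn_const.mul (h1.comp (by fun_prop) hpos)
  rw [curveLength, MeasureTheory.setLIntegral_congr_fun measurableSet_Icc
    fun τ hτ => congrArg ENNReal.ofReal (hder τ hτ),
    ← MeasureTheory.ofReal_integral_eq_lintegral_ofReal hc.integrableOn_Icc
      (Eventually.of_forall fun τ => mul_nonneg (abs_nonneg _) (Real.sqrt_nonneg _)),
    MeasureTheory.integral_Icc_eq_integral_Ioc,
    ← intervalIntegral.integral_of_le zero_le_one, intervalIntegral.integral_const_mul]
  refine ENNReal.ofReal_le_ofReal (le_of_eq ?_)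
  have h1 := intervalIntegral.mul_integral_comp_add_mul (a := 0) (b := 1) (f := speedFn g)
    (b - a) a
  rw [mul_zero, mul_one, add_zero, add_sub_cancel] at h1
  rw [← h1, abs_mul, abs_of_nonneg (a := ∫ x in (0 : ℝ)..1, _)
    (intervalIntegral.integral_nonneg zero_le_one fun τ _ => speedFn_nonneg _ _)]

lemma tendsto_axis_northPole : Tendsto
    (fun q => stereo n 1 (Real.sqrt q • coordVec n 0)) atTop (𝓝 (northPole n)) := by
  have h1 : ContinuousAt (meridian n) 1 := by
    have : Continuous fun x : ℝ => (Real.sqrt (1 - x ^ 2) • coordVec n 0, x) := by fun_prop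
    exact ((WithLp.prodContinuousLinearEquiv 2 ℝ (Model n) ℝ).symm.continuous.comp
      this).continuousAt
  have h2 : meridian n 1 = northPole n := by simp [meridian, northPole]
  rw [← h2]
  refine (h1.tendsto.comp (tendsto_height_sqrt.mono_right nhdsWithin_le_nhds)).congr fun q => ?_
  exact (stereo_axis (by norm_num) (Real.sqrt_nonneg q)).symm

/-- There is no complete forward evolution on the punctured sphere. -/
theorem not_isForwardEvolution_punctured (hn : 2 ≤ n) (hg₀ : IsNeckpinchMetric g₀)
    (hG : IsForwardEvolution g₀ (unitSphere n \ {northPole n}) T G) : False := by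
  obtain ⟨t, ht, q₀, hq₀, hlim, hbar⟩ := exists_barrier hn hg₀ hG
  have hflow := isWarpedFlow hn hG.flow hG.symmetric
  have hmet := hG.flow.1 t ht
  let Q : ℕ → ℝ := fun k => q₀ + 1 + k
  have hQ : ∀ k, q₀ < Q k := fun k => by
    have : (0 : ℝ) ≤ k := k.cast_nonneg
    simp only [Q]
    linarith
  have hQtop : Tendsto Q atTop atTop :=
    tendsto_atTop_add_const_left _ _ tendsto_natCast_atTop_atTop
  let u : ℕ → Ambient n := fun k => stereo n 1 (Real.sqrt (Q k) • coordVec n 0)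
  have hlength : ∀ a b, q₀ < a → a ≤ b → |∫ q in a..b, speedFn (G t) q| ≤
      2 / Real.sqrt (1 / 2) * Real.sqrt (radiusFn (G t) a) := by
    intro a b ha hab
    rw [abs_of_nonneg (intervalIntegral.integral_nonneg hab fun q _ => speedFn_nonneg _ q)]
    exact hflow.integral_speed_le ht (by norm_num) (hq₀.trans ha) hab
      (fun q hq => (hbar q (ha.trans_le hq.1)).1) (fun q hq => (hbar q (ha.trans_le hq.1)).2)
  have hcauchy : ∀ ε : ℝ≥0∞, 0 < ε → ∃ N, ∀ k ≥ N, ∀ l ≥ N,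
      riemDist (unitSphere n \ {northPole n}) (G t) (u k) (u l) < ε := by
    intro ε hε
    have hl : Tendsto (fun q => ENNReal.ofReal
        (2 / Real.sqrt (1 / 2) * Real.sqrt (radiusFn (G t) q))) atTop (𝓝 0) := by
      have := ENNReal.tendsto_ofReal (hlim.sqrt.const_mul (2 / Real.sqrt (1 / 2)))
      simpa using this
    obtain ⟨N, hN⟩ := eventually_atTop.1 ((hl.comp hQtop).eventually_lt_const hε)
    refine ⟨N, fun k hk l hl => ?_⟩
    refine (riemDist_le hmet (hq₀.trans (hQ k)) (hq₀.trans (hQ l))).trans_lt ?_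
    rcases le_total (Q k) (Q l) with h | h
    · exact (ENNReal.ofReal_le_ofReal (hlength _ _ (hQ k) h)).trans_lt (hN k hk)
    · rw [intervalIntegral.integral_symm, abs_neg]
      exact (ENNReal.ofReal_le_ofReal (hlength _ _ (hQ l) h)).trans_lt (hN l hl)
  obtain ⟨p, hp, hup⟩ := hG.complete t ht u (fun k => stereo_one_mem _) hcauchy
  exact hp.2 (tendsto_nhds_unique hup (tendsto_axis_northPole.comp hQtop))

end Incomplete

/-! ### The radial profile of a smooth metric at the north pole -/

section Pole

variable {n : ℕ}

lemma stereo_mem_unitSphere {ε : ℝ} (hε : ε ^ 2 = 1) (y : Model n) :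
    stereo n ε y ∈ unitSphere n := by
  simpa [unitSphere] using norm_stereo hε y

lemma height_sqrt_div {x : ℝ} (hx : x ∈ Ioo (-1 : ℝ) 1) :
    height (-1) (Real.sqrt ((1 - x) / (1 + x))) = x := by
  have h1 : 0 < 1 + x := by linarith [hx.1]
  have h2 : 0 < 1 - x := by linarith [hx.2]
  rw [height, Real.sq_sqrt (by positivity)]
  field_simp
  ring

lemma sqrt_div_height {ρ : ℝ} (hρ : 0 ≤ ρ) :
    Real.sqrt ((1 - height (-1) ρ) / (1 + height (-1) ρ)) = ρ := by
  have : (1 - height (-1) ρ) / (1 + height (-1) ρ) = ρ ^ 2 := by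
    have h : (1 : ℝ) + height (-1) ρ = 2 / (ρ ^ 2 + 1) := by
      rw [height]
      field_simp
      ring
    have h' : (1 : ℝ) - height (-1) ρ = 2 * ρ ^ 2 / (ρ ^ 2 + 1) := by
      rw [height]
      field_simp
      ring
    rw [h, h']
    field_simp
  rw [this, Real.sqrt_sq hρ]

lemma hasDerivAt_sqrt_div {x : ℝ} (hx : x ∈ Ioo (-1 : ℝ) 1) :
    HasDerivAt (fun x : ℝ => Real.sqrt ((1 - x) / (1 + x)))
      (-((Real.sqrt ((1 - x) / (1 + x)) ^ 2 + 1) ^ 2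
        / (4 * Real.sqrt ((1 - x) / (1 + x))))) x := by
  have h1 : 0 < 1 + x := by linarith [hx.1]
  have h2 : 0 < 1 - x := by linarith [hx.2]
  have hp : 0 < (1 - x) / (1 + x) := by positivity
  refine ((((hasDerivAt_id x).const_sub 1).div ((hasDerivAt_id x).const_add 1)
    h1.ne').sqrt hp.ne').congr_deriv ?_
  have hs := Real.sqrt_pos.2 hp
  simp only [id, Pi.div_apply]
  have e : Real.sqrt ((1 - x) / (1 + x)) ^ 2 + 1 = 2 / (1 + x) := by
    rw [Real.sq_sqrt hp.le]
    field_simp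
    ring
  rw [e]
  field_simp
  ring

/-- A smooth rotationally symmetric metric on the sphere has a radial profile at the north pole
that extends continuously with value `1`. -/
theorem exists_isRadialProfile (hn : 2 ≤ n) {g : FormField n}
    (hg : IsRiemannianMetric (unitSphere n) g) (hsym : IsRotationallySymmetric (unitSphere n) g) :
    ∃ (x₁ r₁ : ℝ) (v : ℝ → ℝ), IsRadialProfile g x₁ r₁ v ∧
      ContinuousWithinAt v (Ici 0) 0 ∧ v 0 = 1 := by
  have hε : (-1 : ℝ) ^ 2 = 1 := by norm_num
  have hn1 : 1 ≤ n := by omega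
  set c : Fin (n + 1) → ℝ → ℝ := fun i ρ => coeff g (stereo n (-1)) (ρ • coordVec n 0) i i with hc
  have hchart := hg _ (stereoS_mem_atlas n)
  have hpre : stereo n (-1) ⁻¹' unitSphere n = univ :=
    eq_univ_of_forall (stereo_mem_unitSphere hε)
  have cc : ∀ i, ContDiff ℝ ∞ (c i) := by
    intro i
    have := hchart.2 i i
    rw [hpre, contDiffOn_univ] at this
    exact this.comp (contDiff_id.smul contDiff_const)
  have cpos : ∀ i ρ, 0 < c i ρ := fun i ρ =>
    (hchart.1 _ (stereo_mem_unitSphere hε _)).diag_pos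
  have c0 : c 0 0 = c (Fin.last n) 0 := by
    simp only [hc, zero_smul]
    exact coeff_pole hn1 hsym hε (stereo_mem_unitSphere hε 0)
  set r : ℝ → ℝ := fun ρ => ρ * Real.sqrt (c (Fin.last n) ρ) with hr
  have cr : ContDiff ℝ ∞ r := contDiff_id.mul ((cc _).sqrt fun ρ => (cpos _ ρ).ne')
  have dr : ∀ ρ, HasDerivAt r (deriv r ρ) ρ := fun ρ =>
    (cr.differentiable (by simp) ρ).hasDerivAt
  have cdr : Continuous (deriv r) := cr.continuous_deriv (by simp)
  have r0 : r 0 = 0 := by simp [hr]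
  have dr0 : deriv r 0 = Real.sqrt (c (Fin.last n) 0) := by
    have h1 : HasDerivAt (fun ρ => Real.sqrt (c (Fin.last n) ρ)) _ 0 :=
      ((((cc (Fin.last n)).sqrt fun ρ => (cpos _ ρ).ne').differentiable (by simp)) 0).hasDerivAt
    have h2 : HasDerivAt r _ 0 := (hasDerivAt_id (0 : ℝ)).mul h1
    rw [h2.deriv]
    simp
  obtain ⟨δ, hδ, hball⟩ : ∃ δ > 0, ∀ ρ, |ρ| < δ → 0 < deriv r ρ := by
    have h1 : ∀ᶠ ρ in 𝓝 (0 : ℝ), 0 < deriv r ρ :=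
      cdr.continuousAt.eventually_const_lt (by rw [dr0]; exact Real.sqrt_pos.2 (cpos _ _))
    obtain ⟨δ, hδ, h⟩ := Metric.eventually_nhds_iff.1 h1
    exact ⟨δ, hδ, fun ρ hρ => h (by simpa using hρ)⟩
  set ρ₁ : ℝ := δ / 2 with hρ₁
  have hρ₁0 : 0 < ρ₁ := half_pos hδ
  have hdpos : ∀ ρ ∈ Icc 0 ρ₁, 0 < deriv r ρ := fun ρ hρ =>
    hball ρ (by rw [abs_of_nonneg hρ.1]; linarith [hρ.2])
  have hmono : StrictMonoOn r (Icc 0 ρ₁) :=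
    strictMonoOn_of_deriv_pos (convex_Icc 0 ρ₁) cr.continuous.continuousOn
      fun ρ hρ => hdpos ρ (interior_subset hρ)
  have himg : ∀ s ∈ Ico 0 (r ρ₁), ∃ ρ ∈ Ico 0 ρ₁, r ρ = s := by
    intro s hs
    obtain ⟨ρ, hρ, e⟩ := intermediate_value_Icc hρ₁0.le cr.continuous.continuousOn
      (show s ∈ Icc (r 0) (r ρ₁) from ⟨by rw [r0]; exact hs.1, hs.2.le⟩)
    refine ⟨ρ, ⟨hρ.1, lt_of_le_of_ne hρ.2 ?_⟩, e⟩
    rintro rfl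
    exact hs.2.ne e.symm
  set k : ℝ → ℝ := Function.invFunOn r (Ico 0 ρ₁) with hk
  have hkmem : ∀ s ∈ Ico 0 (r ρ₁), k s ∈ Ico 0 ρ₁ := fun s hs =>
    Function.invFunOn_mem (himg s hs)
  have hrk : ∀ s ∈ Ico 0 (r ρ₁), r (k s) = s := fun s hs => Function.invFunOn_eq (himg s hs)
  have hr₁ : 0 < r ρ₁ := mul_pos hρ₁0 (Real.sqrt_pos.2 (cpos _ _))
  have hsubI : Ico 0 ρ₁ ⊆ Icc 0 ρ₁ := Ico_subset_Icc_self
  have hkr : ∀ ρ ∈ Ico 0 ρ₁, k (r ρ) = ρ := by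
    intro ρ hρ
    have hm : r ρ ∈ Ico 0 (r ρ₁) := by
      refine ⟨mul_nonneg hρ.1 (Real.sqrt_nonneg _), hmono (hsubI hρ) ⟨hρ₁0.le, le_rfl⟩ hρ.2⟩
    exact hmono.injOn (hsubI (hkmem _ hm)) (hsubI hρ) (hrk _ hm)
  have hk0 : k 0 = 0 := by
    have := hkr 0 ⟨le_rfl, hρ₁0⟩
    rwa [r0] at this
  set V : ℝ → ℝ := fun ρ => deriv r ρ ^ 2 / c 0 ρ with hV
  have V0 : V 0 = 1 := by
    simp only [hV, dr0, c0]
    rw [Real.sq_sqrt (cpos _ _).le, div_self (cpos _ _).ne']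
  have hVc : Continuous V := (cdr.pow 2).div (cc 0).continuous fun ρ => (cpos 0 ρ).ne'
  have hkc : ContinuousWithinAt k (Ici 0) 0 := by
    rw [Metric.continuousWithinAt_iff]
    intro ε hε
    set η := min ε (ρ₁ / 2) with hη
    have hη0 : 0 < η := lt_min hε (half_pos hρ₁0)
    have hη1 : η < ρ₁ := (min_le_right _ _).trans_lt (half_lt_self hρ₁0)
    refine ⟨r η, mul_pos hη0 (Real.sqrt_pos.2 (cpos _ _)), fun {s} hs hs' => ?_⟩
    rw [Real.dist_eq, sub_zero, abs_of_nonneg hs] at hs'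
    have hlt : r η < r ρ₁ := hmono ⟨hη0.le, hη1.le⟩ ⟨hρ₁0.le, le_rfl⟩ hη1
    have hm : s ∈ Ico 0 (r ρ₁) := ⟨hs, hs'.trans hlt⟩
    have hks := hkmem s hm
    have : k s < η := by
      rw [← hrk s hm] at hs'
      exact (hmono.lt_iff_lt (hsubI hks) ⟨hη0.le, hη1.le⟩).1 hs'
    rw [hk0, Real.dist_eq, sub_zero, abs_of_nonneg hks.1]
    exact this.trans_le (min_le_left _ _)
  have horb : ∀ x ∈ Ioo (-1 : ℝ) 1, orbitRadius g x = r (Real.sqrt ((1 - x) / (1 + x))) := by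
    intro x hx
    have hs := Real.sqrt_nonneg ((1 - x) / (1 + x))
    have h1 := orbitRadius_eq hn1 hε g hs
    rw [height_sqrt_div hx, Real.sqrt_mul (sq_nonneg _), Real.sqrt_sq hs] at h1
    exact h1
  have hx₁ : height (-1) ρ₁ ∈ Ioo (-1 : ℝ) 1 := height_mem hε hρ₁0
  have hPmem : ∀ x ∈ Ioo (height (-1) ρ₁) 1,
      x ∈ Ioo (-1 : ℝ) 1 ∧ Real.sqrt ((1 - x) / (1 + x)) ∈ Ioo 0 ρ₁ := by
    intro x hx
    have hx' : x ∈ Ioo (-1 : ℝ) 1 := ⟨hx₁.1.trans hx.1, hx.2⟩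
    have h1 : 0 < 1 + x := by linarith [hx'.1]
    have h2 : 0 < 1 - x := by linarith [hx'.2]
    have h3 : 0 < 1 + height (-1) ρ₁ := by linarith [hx₁.1]
    refine ⟨hx', Real.sqrt_pos.2 (by positivity), ?_⟩
    rw [← sqrt_div_height hρ₁0.le]
    refine Real.sqrt_lt_sqrt (by positivity) ?_
    rw [div_lt_div_iff₀ h1 h3]
    nlinarith [hx.1]
  have hder : ∀ x ∈ Ioo (height (-1) ρ₁) 1, HasDerivAt (orbitRadius g)
      (deriv r (Real.sqrt ((1 - x) / (1 + x))) * (-((Real.sqrt ((1 - x) / (1 + x)) ^ 2 + 1) ^ 2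
        / (4 * Real.sqrt ((1 - x) / (1 + x)))))) x := by
    intro x hx
    have hx' := (hPmem x hx).1
    refine ((dr _).comp x (hasDerivAt_sqrt_div hx')).congr_of_eventuallyEq ?_
    filter_upwards [isOpen_Ioo.mem_nhds hx'] with z hz using horb z hz
  refine ⟨height (-1) ρ₁, r ρ₁, V ∘ k, ⟨hx₁, hr₁, ⟨?_, ?_, ?_⟩, ?_, ?_, ?_, ?_⟩, ?_, ?_⟩
  · intro x hx
    obtain ⟨hx', hP⟩ := hPmem x hx
    rw [horb x hx']
    exact ⟨mul_pos hP.1 (Real.sqrt_pos.2 (cpos _ _)),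
      hmono ⟨hP.1.le, hP.2.le⟩ ⟨hρ₁0.le, le_rfl⟩ hP.2⟩
  · intro x hx y hy hxy
    obtain ⟨hx', hP⟩ := hPmem x hx
    obtain ⟨hy', hP'⟩ := hPmem y hy
    rw [horb x hx', horb y hy'] at hxy
    have := hmono.injOn ⟨hP.1.le, hP.2.le⟩ ⟨hP'.1.le, hP'.2.le⟩ hxy
    rw [← height_sqrt_div hx', this, height_sqrt_div hy']
  · intro s hs
    obtain ⟨ρ, hρ, rfl⟩ := himg s ⟨hs.1.le, hs.2⟩
    have hρ0 : 0 < ρ := lt_of_le_of_ne hρ.1 fun e => by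
      rw [← e, r0] at hs
      exact lt_irrefl _ hs.1
    have hm := height_mem hε hρ0
    refine ⟨height (-1) ρ, ⟨?_, hm.2⟩, ?_⟩
    · rw [height, height, neg_one_mul, neg_one_mul, neg_lt_neg_iff,
        div_lt_div_iff₀ (by positivity) (by positivity)]
      nlinarith [hρ.2]
    · rw [horb _ hm, sqrt_div_height hρ.1]
  · exact fun x hx => (hder x hx).differentiableAt
  · intro x hx
    obtain ⟨hx', hP⟩ := hPmem x hx
    rw [(hder x hx).deriv]
    have h1 := hdpos _ ⟨hP.1.le, hP.2.le⟩
    have h2 := hP.1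
    exact mul_neg_of_pos_of_neg h1 (neg_neg_of_pos (by positivity))
  · intro s hs
    have hm := hkmem s ⟨hs.1.le, hs.2⟩
    exact div_pos (pow_pos (hdpos _ (hsubI hm)) 2) (cpos _ _)
  · intro x hx
    obtain ⟨hx', hP⟩ := hPmem x hx
    rw [(hder x hx).deriv, horb x hx', Function.comp_apply, hkr _ ⟨hP.1.le, hP.2⟩]
    have h1 := sqrt_coeff_zero hε g hP.1
    rw [height_sqrt_div hx'] at h1
    set ρ := Real.sqrt ((1 - x) / (1 + x)) with hρ
    have hρ0 := hP.1
    have hd := hdpos _ ⟨hP.1.le, hP.2.le⟩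
    have h2 : (4 * ρ / (ρ ^ 2 + 1) ^ 2 * meridianSpeed g x) ^ 2 = c 0 ρ := by
      rw [← h1]
      exact Real.sq_sqrt (cpos 0 ρ).le
    have hc0 := cpos 0 ρ
    simp only [hV]
    rw [← h2] at hc0 ⊢
    have hms : meridianSpeed g x ≠ 0 := by
      intro h0
      rw [h0] at hc0
      simp at hc0
    field_simp
  · have : ContinuousAt V (k 0) := hVc.continuousAt
    exact this.comp_continuousWithinAt hkc
  · rw [Function.comp_apply, hk0, V0]

end Pole

lemma isCompact_unitSphere (n : ℕ) : IsCompact (unitSphere n) := by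
  have : ProperSpace (Ambient n) := FiniteDimensional.proper_real _
  exact isCompact_sphere 0 1

end

end Neckpinch

theorem mainTheorem2 (n : ℕ) (hn : 2 ≤ n) (g₀ : Neckpinch.FormField n)
    (hg₀ : Neckpinch.IsNeckpinchMetric g₀) (M : Set (Neckpinch.Ambient n)) (T : ℝ)
    (g : ℝ → Neckpinch.FormField n) (hg : Neckpinch.IsForwardEvolution g₀ M T g) :
    IsCompact M ∧
      ∀ t ∈ Set.Ioo 0 T, ∃ (x₁ r₁ : ℝ) (v : ℝ → ℝ),
        Neckpinch.IsRadialProfile (g t) x₁ r₁ v ∧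
          ContinuousWithinAt v (Set.Ici 0) 0 ∧ v 0 = 1 := by
  rcases hg.manifold with rfl | rfl
  · exact ⟨Neckpinch.isCompact_unitSphere n, fun t ht =>
      Neckpinch.exists_isRadialProfile hn (hg.flow.1 t ht) (hg.symmetric t ht)⟩
  · exact (Neckpinch.not_isForwardEvolution_punctured hn hg₀ hg).elim
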